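/- Let $0<s<1$, $G_s=\{z\in\mathbb C: s<|z|<1\}$, $\partial G_s=s\mathbb T\cup\mathbb T$, where $\mathbb T$ is the unit circle, and let $\mu$ be angular measure on $\partial G_s$ normalized so that each of the two circles has mass $1$. For $k\in\mathbb N$ let $H^{k,\infty}(G_s)$ be the space of analytic functions $f$ on $G_s$ such that $f^{(i)}$ is bounded on $G_s$ for $0\le i\le k$. Such derivatives are identified with their boundary functions on $\partial G_s$, given $\mu$-a.e. by radial limits. For $E\subseteq\partial G_s$ put $$\|f\|_{H^{k,\infty}(E)}=\max_{0\le i\le k}\Big(\|f^{(i)}\|_{L^\infty(E\cap s\mathbb T)}+\|f^{(i)}\|_{L^\infty(E\cap\mathbb T)}\Big),\qquad \|f\|_{H^{k,\infty}(G_s)}=\|f\|_{H^{k,\infty}(\partial G_s)}.$$ For a nonempty connected relatively open set $I\subseteq\partial G_s$ put $\lambda=\mu(I)\in(0,1]$ and $\|f\|_{L^1(I)}=\frac1\lambda\int_I|f|\,d\mu$. Let $$q_0=-\log s,\qquad C_s=\inf_{|t|\le\pi}\frac1{2q_0}\sum_{n\in\mathbb Z}\frac1{1+\cosh\left(\frac{\pi}{q_0}(t+2\pi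 n)\right)}.$$ **Corollary 3.8.** Let $K>0$ and let $0\le j<k$ be integers. There exist constants $C,\varepsilon>0$ depending only on $K,k,j,s$ and $\lambda$ such that for every $I$ as above with $\mu(I)=\lambda$ and every $f\in H^{k,\infty}(G_s)$ with $$\|f\|_{H^{k,\infty}(G_s)}\le K,\qquad \|f\|_{H^{j,\infty}(I)}<e^{-q_0/(\lambda C_s)},\qquad \|f\|_{L^1(I)}<\varepsilon,$$ one has $$\|f\|_{H^{j,\infty}(\partial G_s)}\le\frac{C}{\big|\log\|f\|_{L^1(I)}\big|^{k-j}},$$ where the right-hand side is read as $0$ if $\|f\|_{L^1(I)}=0$. -/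

import Mathlib

open MeasureTheory Filter Topology
open scoped ENNReal

noncomputable section

namespace AnnulusHardy

/-- The annulus `G_s = {z : s < |z| < 1}`. -/
def annulus (s : ℝ) : Set ℂ := {z | s < ‖z‖ ∧ ‖z‖ < 1}

/-- The boundary `∂G_s`, the union of the circles of radius `s` and `1` about `0`. -/
def bdry (s : ℝ) : Set ℂ := Metric.sphere 0 s ∪ Metric.sphere 0 1

/-- Normalized angular measure `dθ / (2π)` on the circle of radius `r` about `0`. -/
def circleMeasure (r : ℝ) : Measure ℂ :=
  Measure.map (circleMap 0 r)
    (ENNReal.ofReal (1 / (2 * Real.pi)) • volume.restrict (Set.Ioc 0 (2 * Real.pi)))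

/-- The measure `μ` on `∂G_s` for which each of the two circles has mass one. -/
def bdryMeasure (s : ℝ) : Measure ℂ := circleMeasure s + circleMeasure 1

/-- `f` belongs to `H^∞(G_s)`: it is analytic and bounded on the annulus. -/
def MemHardy (s : ℝ) (f : ℂ → ℂ) : Prop :=
  DifferentiableOn ℂ f (annulus s) ∧ ∃ M : ℝ, ∀ z ∈ annulus s, ‖f z‖ ≤ M

/-- `f` belongs to `H^{k,∞}(G_s)`: all complex derivatives of order at most `k` are in
`H^∞(G_s)`. -/
def MemHardySobolev (s : ℝ) (k : ℕ) (f : ℂ → ℂ) : Prop :=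
  ∀ i ≤ k, MemHardy s (iteratedDeriv i f)

/-- The boundary function of `f`: its radial limit from inside `G_s` at `ζ ∈ ∂G_s`.
For `f ∈ H^∞(G_s)` this limit exists at almost every `ζ`. -/
def bdryValue (s : ℝ) (f : ℂ → ℂ) (ζ : ℂ) : ℂ :=
  limUnder (𝓝[{r : ℝ | (r : ℂ) * ζ ∈ annulus s}] (1 : ℝ)) (fun r : ℝ => f ((r : ℂ) * ζ))

/-- The norm of `L^∞(E)`, for `E ⊆ ∂G_s`, of the boundary function of `f`. -/
def supNorm (s : ℝ) (E : Set ℂ) (f : ℂ → ℂ) : ℝ≥0∞ :=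
  eLpNorm (bdryValue s f) ∞ ((bdryMeasure s).restrict E)

/-- The norm of `H^{k,∞}(E)`, for `E ⊆ ∂G_s`: the maximum over `0 ≤ i ≤ k` of the sum of
the sup norms of `f^{(i)}` over the parts of `E` on the inner and on the outer circle.
With `E = ∂G_s` it is the norm of `H^{k,∞}(G_s)`. -/
def hardySobolevNorm (s : ℝ) (k : ℕ) (E : Set ℂ) (f : ℂ → ℂ) : ℝ≥0∞ :=
  (Finset.range (k + 1)).sup fun i =>
    supNorm s (E ∩ Metric.sphere 0 s) (iteratedDeriv i f) +
      supNorm s (E ∩ Metric.sphere 0 1) (iteratedDeriv i f)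

/-- The normalized `L^1(I)` norm `(1 / (2πλ)) ∫_I |f(r e^{iθ})| dθ`, where `2πλ` is the angular
length of `I`, i.e. the mean of `|f|` over `I` for the measure `μ`. -/
def l1Norm (s : ℝ) (I : Set ℂ) (f : ℂ → ℂ) : ℝ :=
  ((bdryMeasure s) I).toReal⁻¹ * ∫ ζ in I, ‖bdryValue s f ζ‖ ∂(bdryMeasure s)

/-- `q₀ = - log s`. -/
def q0 (s : ℝ) : ℝ := -Real.log s

/-- `C_s = inf_{|t| ≤ π} (1 / (2 q₀)) ∑_{n ∈ ℤ} 1 / (1 + cosh (π (t + 2πn) / q₀))`. -/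
def kernelConst (s : ℝ) : ℝ :=
  ⨅ t : Set.Icc (-Real.pi) Real.pi,
    1 / (2 * q0 s) *
      ∑' n : ℤ, 1 / (1 + Real.cosh (Real.pi / q0 s * ((t : ℝ) + 2 * Real.pi * (n : ℝ))))

end AnnulusHardy

end

/-! Write `L` for minus the logarithm of the mean of `|f|` over `I`. Four facts combine.

(a) The bound on the boundary values of the derivatives holds inside the annulus, up to a factor `1
/ s` (`norm_iteratedDeriv_le`). Below the top order this is the maximum principle. The top
derivative need not extend continuously, so it is controlled through the Lipschitz boundary function
of the previous one.

(b) `f` is Lipschitz on `I`, so its supremum on a subarc is at most a constant times the square root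
of the mean, hence at most `exp (-3L/8)` for large `L` (`sq_le_integral`).

(c) If `|f| ≤ m` everywhere and `|f| ≤ δ` on an arc, then `|f(z)| ≤ m (δ/m)^(c d)`, where `d` is the
distance from `z` to the boundary: harmonic measure of an arc decays no faster than linearly at the
boundary (`exists_two_constants_annulus`). It is computed on the strip covering the annulus through
`w ↦ exp (i w)`.

(d) Landau's inequality on radial segments gives Kolmogorov inequalities: `|f| ≤ η^k` implies
`|f^(i)| ≤ A η^(k-i)` (`exists_norm_le_interpolation`).

The exponent `k` comes from a self-improvement in `exists_norm_le_pow`. Put `sup |f| = m = η^k`. By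
(d) the derivative is at most of order `η^(k-1)`, so from a near-maximum point one can go a distance
`t` comparable to `η` away from the boundary and still have `|f| ≥ m/2`. There (c), used with `m`
itself as upper constant, gives `1/2 ≤ exp (-c' η L)`. Hence `η` is at most a multiple of `1/L`,
unless `m` is already exponentially small. One more use of (d) turns `|f| ≤ (D/L)^k` into decay
`L^(-(k-i))` of every derivative. -/

namespace AnnulusHardy

/-! ### Maximum principle and harmonic measure in a strip -/

/-- The open horizontal strip `0 < Im w < q`. -/
def strip (q : ℝ) : Set ℂ := Complex.im ⁻¹' Set.Ioo 0 q

/-- The closed horizontal strip `0 ≤ Im w ≤ q`. -/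
def closedStrip (q : ℝ) : Set ℂ := Complex.im ⁻¹' Set.Icc 0 q

theorem isOpen_strip (q : ℝ) : IsOpen (strip q) :=
  isOpen_Ioo.preimage Complex.continuous_im

theorem strip_subset_closedStrip (q : ℝ) : strip q ⊆ closedStrip q := fun _ hw =>
  ⟨hw.1.le, hw.2.le⟩

theorem closure_strip {q : ℝ} (hq : 0 < q) : closure (strip q) = closedStrip q := by
  rw [strip, Complex.closure_preimage_im, closure_Ioo hq.ne, closedStrip]

/-- The maximum principle for bounded functions on a strip. -/
theorem norm_le_of_strip {q : ℝ} (hq : 0 < q) {Φ : ℂ → ℂ} (hd : DiffContOnCl ℂ Φ (strip q))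
    {M : ℝ} (hb : ∀ w ∈ strip q, ‖Φ w‖ ≤ M) {C : ℝ} (h0 : ∀ x : ℝ, ‖Φ x‖ ≤ C)
    (h1 : ∀ x : ℝ, ‖Φ (x + q * Complex.I)‖ ≤ C) {w : ℂ} (hw : w ∈ closedStrip q) :
    ‖Φ w‖ ≤ C := by
  refine PhragmenLindelof.horizontal_strip (a := 0) (b := q) hd
    ⟨0, by simpa using div_pos Real.pi_pos hq, 0, ?_⟩ ?_ ?_ hw.1 hw.2
  · refine Asymptotics.IsBigO.of_bound M ?_
    filter_upwards [mem_inf_of_right (mem_principal_self _)] with w hw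
    simpa using hb w hw
  · intro z hz
    have : z = (z.re : ℂ) := by apply Complex.ext <;> simp [hz]
    rw [this]; exact h0 _
  · intro z hz
    have : z = (z.re : ℂ) + q * Complex.I := by apply Complex.ext <;> simp [hz]
    rw [this]; exact h1 _

/-- The difference of arguments `arg (z - b) - arg (z - a)` is a mean value of the
Poisson kernel of the half-plane. -/
theorem exists_im_log_sub_log_eq {z : ℂ} (hz : 0 < z.im) {a b : ℝ} (hab : a < b) :
    ∃ t ∈ Set.Ioo a b, (Complex.log (z - b) - Complex.log (z - a)).im =
      (b - a) * (z.im / Complex.normSq (z - t)) := by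
  have hd : ∀ t : ℝ, HasDerivAt (fun t : ℝ => (Complex.log (z - t)).im)
      (z.im / Complex.normSq (z - t)) t := by
    intro t
    have h1 : HasDerivAt (fun t : ℝ => z - (t : ℂ)) (-1) t := by
      simpa using (Complex.ofRealCLM.hasDerivAt (x := t)).const_sub z
    have h2 : HasDerivAt (fun t : ℝ => Complex.log (z - t)) (-1 / (z - t)) t := by
      refine h1.clog_real ?_
      right; simpa using hz.ne'
    have h3 := Complex.imCLM.hasFDerivAt.comp_hasDerivAt t h2
    have e : z.im / Complex.normSq (z - t) = Complex.imCLM (-1 / (z - t)) := by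
      simp [neg_div]
    rw [e]; exact h3
  obtain ⟨t, ht, h⟩ := exists_hasDerivAt_eq_slope _ _ hab
    (fun t _ => (hd t).continuousAt.continuousWithinAt) (fun t _ => hd t)
  refine ⟨t, ht, ?_⟩
  rw [h, Complex.sub_im, mul_div_cancel₀ _ (sub_pos.2 hab).ne']

theorem im_log_sub_log_le_pi {z : ℂ} (hz : 0 < z.im) (a b : ℝ) :
    (Complex.log (z - b) - Complex.log (z - a)).im ≤ Real.pi := by
  have h1 : 0 ≤ Complex.arg (z - a) := Complex.arg_nonneg_iff.2 (by simpa using hz.le)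
  have h2 := Complex.arg_le_pi (z - b)
  simp only [Complex.sub_im, Complex.log_im]
  linarith

theorem norm_exp_neg_I_mul (c : ℝ) (h : ℂ) :
    ‖Complex.exp (-Complex.I * c * h)‖ = Real.exp (c * h.im) := by
  rw [Complex.norm_exp]; simp

/-- Jordan's inequality applied on each half of `[0, π]`. It converts the height of `exp (π w / q)`
in the half-plane into distance to the edges of the strip. -/
theorem min_mul_le_sin {q y : ℝ} (hq : 0 < q) (h0 : 0 ≤ y) (h1 : y ≤ q) :
    2 / q * min y (q - y) ≤ Real.sin (Real.pi / q * y) := by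
  have hpi := Real.pi_pos
  rcases le_total y (q / 2) with h | h
  · have := Real.mul_le_sin (x := Real.pi / q * y) (by positivity) (by
      rw [div_mul_eq_mul_div, div_le_div_iff₀ hq two_pos]; nlinarith)
    refine le_trans ?_ this
    rw [min_eq_left (by linarith)]
    apply le_of_eq; field_simp
  · have := Real.mul_le_sin (x := Real.pi / q * (q - y)) (by
      have : 0 ≤ q - y := by linarith
      positivity) (by
      rw [div_mul_eq_mul_div, div_le_div_iff₀ hq two_pos]; nlinarith)
    have e : Real.pi / q * (q - y) = Real.pi - Real.pi / q * y := by field_simp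
    rw [e, Real.sin_pi_sub, ← e] at this
    refine le_trans ?_ this
    rw [min_eq_right (by linarith)]
    apply le_of_eq; field_simp

/-- A two constants theorem in a strip for functions which are small on an interval of the
lower edge, with exponent comparable to the distance to the boundary. -/
theorem exists_two_constants {q : ℝ} (hq : 0 < q) {ρ : ℝ} (hρ : 0 < ρ) (R : ℝ) :
    ∃ c > 0, ∀ (Φ : ℂ → ℂ) (m δ : ℝ), DiffContOnCl ℂ Φ (strip q) →
      (∀ w ∈ closedStrip q, ‖Φ w‖ ≤ m) → 0 < δ → δ ≤ m → (∀ x : ℝ, |x| ≤ 2 * ρ → ‖Φ x‖ ≤ δ) →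
      ∀ w ∈ strip q, |w.re| ≤ R →
        ‖Φ w‖ ≤ m * Real.exp (-(c * min w.im (q - w.im) * Real.log (m / δ))) := by
  have hpi := Real.pi_pos
  -- `w ↦ exp (p w)` maps the strip onto the upper half-plane and `[-ρ, ρ]` onto `[a, b]`. `D` will
  -- bound the distance from the image of `w`, raised by at most `1`, to a point of `[a, b]`.
  set p : ℝ := Real.pi / q with hp
  have hp0 : 0 < p := by positivity
  set a : ℝ := Real.exp (-(p * ρ)) with ha
  set b : ℝ := Real.exp (p * ρ) with hb
  have hpρ : 0 < p * ρ := by positivity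
  have hab : a < b := Real.exp_lt_exp.2 (by linarith)
  have ha0 : 0 < a := Real.exp_pos _
  set D : ℝ := Real.exp (p * R) + 1 + b with hD
  have hD0 : 0 < D := by positivity
  refine ⟨(b - a) / (Real.pi * D ^ 2) * (Real.exp (-(p * R)) * (2 / q)),
    by have := sub_pos.2 hab; positivity, ?_⟩
  intro Φ m δ hd hm hδ hδm hsmall w hw hwR
  have hm0 : 0 < m := hδ.trans_le hδm
  set L := Real.log (m / δ) with hL
  have hL0 : 0 ≤ L := Real.log_nonneg ((one_le_div hδ).2 hδm)
  -- The smallness is assumed on `[-2ρ, 2ρ]` but harmonic measure is taken for `[-ρ, ρ]`. The gap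
  -- `η` between the images keeps the comparison function small on the rest of the boundary.
  obtain ⟨η, hη0, hη1, hη2⟩ : ∃ η > 0, η ≤ Real.exp (2 * (p * ρ)) - b ∧
      η ≤ a - Real.exp (-(2 * (p * ρ))) := by
    refine ⟨min (Real.exp (2 * (p * ρ)) - b) (a - Real.exp (-(2 * (p * ρ)))), ?_,
      min_le_left _ _, min_le_right _ _⟩
    refine lt_min (sub_pos.2 (Real.exp_lt_exp.2 (by linarith)))
      (sub_pos.2 (Real.exp_lt_exp.2 (by linarith)))
  set κ : ℝ := L / Real.pi * ((b - a) / η ^ 2) with hκ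
  -- the covering of the upper half-plane
  have him : ∀ v : ℂ, (Complex.exp (p * v)).im = Real.exp (p * v.re) * Real.sin (p * v.im) := by
    intro v; rw [Complex.exp_im]; simp
  have him0 : ∀ v ∈ closedStrip q, 0 ≤ (Complex.exp (p * v)).im := by
    intro v hv
    rw [him]
    refine mul_nonneg (Real.exp_pos _).le (Real.sin_nonneg_of_nonneg_of_le_pi ?_ ?_)
    · exact mul_nonneg hp0.le hv.1
    · calc p * v.im ≤ p * q := by gcongr; exact hv.2
        _ = Real.pi := by rw [hp]; field_simp
  have key : ∀ τ : ℝ, 0 < τ → τ ≤ 1 → ‖Φ w‖ ≤ m * Real.exp (κ * τ) * Real.exp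
      (-(L / Real.pi * ((b - a) * ((Complex.exp (p * w)).im / D ^ 2)))) := by
    intro τ hτ hτ1
    -- Raising by `iτ` keeps both logarithms analytic up to the edges; the price is a factor `exp (κ
    -- τ)`, removed at the end by `τ → 0`.
    set Z : ℂ → ℂ := fun v => Complex.exp (p * v) + τ * Complex.I with hZ
    have hZim : ∀ v, (Z v).im = (Complex.exp (p * v)).im + τ := by intro v; simp [hZ]
    have hZre : ∀ v, (Z v).re = (Complex.exp (p * v)).re := by intro v; simp [hZ]
    have hZ0 : ∀ v ∈ closedStrip q, 0 < (Z v).im := by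
      intro v hv; rw [hZim]; have := him0 v hv; linarith
    set H : ℂ → ℂ := fun v => Complex.log (Z v - b) - Complex.log (Z v - a) with hH
    have hHd : ∀ v ∈ closedStrip q, DifferentiableAt ℂ H v := by
      intro v hv
      have h0 : DifferentiableAt ℂ Z v := by simp only [hZ]; fun_prop
      refine DifferentiableAt.sub (DifferentiableAt.clog (h0.sub_const _) (Or.inr ?_))
        (DifferentiableAt.clog (h0.sub_const _) (Or.inr ?_)) <;>
      simpa using (hZ0 v hv).ne'
    -- `Im H / π` approximates the harmonic measure of `[a, b]`, so the added factor has modulus at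
    -- most `exp L = m / δ`, exactly what the small part of the edge can absorb.
    set g : ℂ → ℂ := fun v => Φ v * Complex.exp (-Complex.I * ((L / Real.pi : ℝ) : ℂ) * H v) with hg
    have hE : ∀ v ∈ closedStrip q, DifferentiableAt ℂ
        (fun v => Complex.exp (-Complex.I * ((L / Real.pi : ℝ) : ℂ) * H v)) v := fun v hv =>
      ((hHd v hv).const_mul _).cexp
    have hgd : DiffContOnCl ℂ g (strip q) := by
      refine ⟨hd.differentiableOn.mul fun v hv =>
        (hE v (strip_subset_closedStrip q hv)).differentiableWithinAt, ?_⟩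
      refine hd.continuousOn.mul fun v hv => ?_
      rw [closure_strip hq] at hv
      exact (hE v hv).continuousAt.continuousWithinAt
    have hgn : ∀ v, ‖g v‖ = ‖Φ v‖ * Real.exp (L / Real.pi * (H v).im) := by
      intro v; rw [hg]; simp only [norm_mul, norm_exp_neg_I_mul]
    have hLpi : 0 ≤ L / Real.pi := by positivity
    have hpi_le : ∀ v ∈ closedStrip q, Real.exp (L / Real.pi * (H v).im) ≤ Real.exp L := by
      intro v hv
      rw [Real.exp_le_exp]
      calc L / Real.pi * (H v).im ≤ L / Real.pi * Real.pi := by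
            gcongr; exact im_log_sub_log_le_pi (hZ0 v hv) a b
        _ = L := by field_simp
    have hfar : ∀ v ∈ closedStrip q, (Complex.exp (p * v)).im = 0 →
        ((Complex.exp (p * v)).re ≤ a - η ∨ b + η ≤ (Complex.exp (p * v)).re) →
        ‖g v‖ ≤ m * Real.exp (κ * τ) := by
      intro v hv hv0 hv1
      rw [hgn]
      refine mul_le_mul (hm v hv) ?_ (Real.exp_pos _).le hm0.le
      obtain ⟨t, ht, h⟩ := exists_im_log_sub_log_eq (hZ0 v hv) hab
      rw [Real.exp_le_exp, hκ, mul_assoc]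
      refine mul_le_mul_of_nonneg_left ?_ hLpi
      rw [hH]; dsimp only; rw [h, hZim, hv0, zero_add, div_mul_eq_mul_div, mul_div_assoc]
      -- At height `τ` and horizontal distance at least `η` the Poisson kernel is at most `τ / η²`;
      -- this is where `κ` comes from.
      have : η ^ 2 ≤ Complex.normSq (Z v - t) := by
        rw [Complex.normSq_apply]
        simp only [Complex.sub_re, Complex.ofReal_re, hZre]
        have h3 : η ^ 2 ≤ ((Complex.exp (p * v)).re - t) ^ 2 := by
          rcases hv1 with h1 | h1
          · have := ht.1
            nlinarith
          · have := ht.2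
            nlinarith
        nlinarith [mul_self_nonneg ((Z v - t).im)]
      have := sub_pos.2 hab
      gcongr
    have hgw : ‖g w‖ ≤ m * Real.exp (κ * τ) := by
      have hκ0 : 0 ≤ κ := by have := sub_pos.2 hab; positivity
      refine norm_le_of_strip hq hgd (M := m * Real.exp L) ?_ ?_ ?_ (strip_subset_closedStrip q hw)
      · intro v hv
        rw [hgn]
        have hv' := strip_subset_closedStrip q hv
        exact mul_le_mul (hm v hv') (hpi_le v hv') (Real.exp_pos _).le hm0.le
      · intro x
        have hx : (x : ℂ) ∈ closedStrip q := by simp [closedStrip, hq.le]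
        have hre : Complex.exp (p * (x : ℂ)) = (Real.exp (p * x) : ℂ) := by push_cast; rfl
        by_cases hxρ : |x| ≤ 2 * ρ
        · rw [hgn]
          calc ‖Φ x‖ * Real.exp (L / Real.pi * (H x).im) ≤ δ * Real.exp L :=
                mul_le_mul (hsmall x hxρ) (hpi_le x hx) (Real.exp_pos _).le hδ.le
            _ = m * 1 := by rw [hL, Real.exp_log (by positivity)]; field_simp
            _ ≤ m * Real.exp (κ * τ) := by
                gcongr; exact Real.one_le_exp (by positivity)
        · refine hfar x hx ?_ ?_
          · rw [hre]; exact Complex.ofReal_im _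
          · rw [hre, Complex.ofReal_re]
            push Not at hxρ
            rcases lt_abs.1 hxρ with h | h
            · right
              have : Real.exp (2 * (p * ρ)) ≤ Real.exp (p * x) := Real.exp_le_exp.2 (by nlinarith)
              linarith
            · left
              have : Real.exp (p * x) ≤ Real.exp (-(2 * (p * ρ))) :=
                Real.exp_le_exp.2 (by nlinarith)
              linarith
      · intro x
        have hx : (x + q * Complex.I : ℂ) ∈ closedStrip q := by simp [closedStrip, hq.le]
        have hre : Complex.exp (p * (x + q * Complex.I : ℂ)) = ((-Real.exp (p * x) : ℝ) : ℂ) := by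
          have : (p * (x + q * Complex.I) : ℂ) = ((p * x : ℝ) : ℂ) + Real.pi * Complex.I := by
            have : (p : ℂ) * q = Real.pi := by
              rw [← Complex.ofReal_mul, hp, div_mul_cancel₀ _ hq.ne']
            push_cast; linear_combination Complex.I * this
          rw [this, Complex.exp_add, Complex.exp_pi_mul_I]; push_cast; ring
        refine hfar _ hx ?_ ?_
        · rw [hre]; exact Complex.ofReal_im _
        · left; rw [hre, Complex.ofReal_re]
          have h1 := Real.exp_pos (p * x)
          have h2 := Real.exp_pos (-(2 * (p * ρ)))
          linarith
    have hw' := strip_subset_closedStrip q hw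
    have hlow : (b - a) * ((Complex.exp (p * w)).im / D ^ 2) ≤ (H w).im := by
      obtain ⟨t, ht, h⟩ := exists_im_log_sub_log_eq (hZ0 w hw') hab
      rw [hH]; dsimp only; rw [h]
      have h1 : 0 < Complex.normSq (Z w - t) := by
        rw [Complex.normSq_pos]
        intro h0
        have := congrArg Complex.im h0
        simp at this
        exact (hZ0 w hw').ne' this
      have h2 : Complex.normSq (Z w - t) ≤ D ^ 2 := by
        rw [Complex.normSq_eq_norm_sq]
        have : ‖Z w - t‖ ≤ D := by
          calc ‖Z w - t‖ ≤ ‖Complex.exp (p * w)‖ + ‖(τ * Complex.I : ℂ)‖ + ‖(t : ℂ)‖ := by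
                refine (norm_sub_le _ _).trans ?_
                gcongr
                exact norm_add_le _ _
            _ ≤ Real.exp (p * R) + 1 + b := by
                have ht0 : 0 < t := ha0.trans ht.1
                rw [Complex.norm_exp, norm_mul, Complex.norm_I, Complex.norm_real,
                  Complex.norm_real, Real.norm_of_nonneg hτ.le, Real.norm_of_nonneg ht0.le, mul_one]
                have : (p * w : ℂ).re = p * w.re := by simp
                rw [this]
                have := (abs_le.1 hwR).2
                gcongr
                exact ht.2.le
        gcongr
      have h3 := him0 w hw'
      have := sub_pos.2 hab
      rw [hZim]
      gcongr
      linarith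
    have e1 : ‖Φ w‖ = ‖g w‖ * Real.exp (-(L / Real.pi * (H w).im)) := by
      rw [hgn, mul_assoc, ← Real.exp_add]; simp
    rw [e1]
    gcongr
  have hlim : Tendsto (fun τ : ℝ => m * Real.exp (κ * τ) * Real.exp
      (-(L / Real.pi * ((b - a) * ((Complex.exp (p * w)).im / D ^ 2))))) (𝓝[>] 0)
      (𝓝 (m * Real.exp (κ * 0) * Real.exp
      (-(L / Real.pi * ((b - a) * ((Complex.exp (p * w)).im / D ^ 2)))))) := by
    refine Tendsto.mono_left (Continuous.tendsto ?_ 0) nhdsWithin_le_nhds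
    fun_prop
  have hfin := ge_of_tendsto hlim (b := ‖Φ w‖) (by
    filter_upwards [Ioc_mem_nhdsGT one_pos] with τ hτ
    exact key τ hτ.1 hτ.2)
  refine hfin.trans ?_
  rw [mul_zero, Real.exp_zero, mul_one]
  refine mul_le_mul_of_nonneg_left (Real.exp_le_exp.2 (neg_le_neg ?_)) hm0.le
  rw [him]
  have h1 := min_mul_le_sin hq hw.1.le hw.2.le
  have h2 : Real.exp (-(p * R)) ≤ Real.exp (p * w.re) := Real.exp_le_exp.2 (by
    have := (abs_le.1 hwR).1; nlinarith)
  have h0 : 0 ≤ min w.im (q - w.im) := le_min hw.1.le (by linarith [hw.2])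
  have h3 : Real.exp (-(p * R)) * (2 / q * min w.im (q - w.im)) ≤
      Real.exp (p * w.re) * Real.sin (p * w.im) := by
    gcongr
  have := sub_pos.2 hab
  calc (b - a) / (Real.pi * D ^ 2) * (Real.exp (-(p * R)) * (2 / q)) * min w.im (q - w.im) * L
      = L / Real.pi * ((b - a) * ((Real.exp (-(p * R)) * (2 / q * min w.im (q - w.im))) / D ^ 2)) := by
        field_simp
    _ ≤ _ := by gcongr

/-! ### Boundary derivatives of Lipschitz functions -/

/-- Fatou's theorem for the derivative of a Lipschitz function on a strip: where the boundary
function is differentiable, the derivative has the corresponding limit along the normal. -/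
theorem tendsto_deriv_of_hasDerivAt_edge {q M : ℝ} (hq : 0 < q) {Φ : ℂ → ℂ}
    (hd : DiffContOnCl ℂ Φ (strip q))
    (hL : ∀ v ∈ closedStrip q, ∀ w ∈ closedStrip q, ‖Φ v - Φ w‖ ≤ M * ‖v - w‖)
    {θ : ℝ} {a : ℂ} (ha : HasDerivAt (fun x : ℝ => Φ x) a θ) :
    Tendsto (fun y : ℝ => deriv Φ (θ + y * Complex.I)) (𝓝[>] 0) (𝓝 a) := by
  have hθ : (θ : ℂ) ∈ closedStrip q := by simp [closedStrip, hq.le]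
  set Ψ : ℂ → ℂ := fun w => Φ w - Φ θ - a * (w - θ) with hΨ
  have hM : 0 ≤ M := by
    have h1 : (θ : ℂ) + 1 ∈ closedStrip q := by simp [closedStrip, hq.le]
    have := (norm_nonneg _).trans (hL _ h1 _ hθ)
    simpa using this
  set M' := M + ‖a‖ + 1 with hM'
  have hM'0 : 0 < M' := by positivity
  have hΨ1 : ∀ w ∈ closedStrip q, ‖Ψ w‖ ≤ M' * ‖w - θ‖ := by
    intro w hw
    calc ‖Ψ w‖ ≤ ‖Φ w - Φ θ‖ + ‖a * (w - θ)‖ := norm_sub_le _ _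
      _ ≤ M * ‖w - θ‖ + ‖a‖ * ‖w - θ‖ := by rw [norm_mul]; gcongr; exact hL _ hw _ hθ
      _ ≤ M' * ‖w - θ‖ := by rw [hM']; nlinarith [norm_nonneg (w - θ)]
  have hΨd : DiffContOnCl ℂ Ψ (strip q) := by
    have h : Differentiable ℂ fun w : ℂ => a * (w - θ) := by fun_prop
    exact (hd.sub diffContOnCl_const).sub h.diffContOnCl
  rw [Metric.tendsto_nhds]
  intro ε hε
  -- The Cauchy estimate below yields `(25/4) η y / (y/2) = 25 η / 2`, which is less than `13 η`.
  set η := ε / 13 with hη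
  have hη0 : 0 < η := by positivity
  have hlo := (hasDerivAt_iff_isLittleO.1 ha).bound hη0
  obtain ⟨ρ₀, hρ₀, hball⟩ := Metric.eventually_nhds_iff.1 hlo
  set ρ := min ρ₀ q with hρ
  have hρ0 : 0 < ρ := lt_min hρ₀ hq
  have hev : ∀ᶠ y : ℝ in 𝓝[>] 0, y ∈ Set.Ioc 0 (min (η * ρ / M') (q / 2)) :=
    Ioc_mem_nhdsGT (by positivity)
  filter_upwards [hev] with y hy
  have hy0 := hy.1
  have hy1 : y * M' ≤ η * ρ := (le_div_iff₀ hM'0).1 (hy.2.trans (min_le_left _ _))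
  have hy2 : y ≤ q / 2 := hy.2.trans (min_le_right _ _)
  -- the comparison function
  have hden : ∀ w ∈ closedStrip q, ‖w - θ‖ ^ 2 + y ^ 2 ≤ ‖w - θ + y * Complex.I‖ ^ 2 := by
    intro w hw
    rw [← Complex.normSq_eq_norm_sq, ← Complex.normSq_eq_norm_sq, Complex.normSq_apply,
      Complex.normSq_apply]
    simp
    have := mul_nonneg hw.1 hy0.le
    nlinarith
  have hden0 : ∀ w ∈ closedStrip q, w - θ + y * Complex.I ≠ 0 := by
    intro w hw h0
    have := hden w hw
    rw [h0] at this
    have h1 : 0 < y ^ 2 := by positivity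
    have h2 : 0 ≤ ‖w - θ‖ ^ 2 := by positivity
    simp at this
    linarith
  -- The pole `θ - iy` lies outside the closed strip, and the kernel has modulus at most `y / (|w -
  -- θ|² + y²)`. On the edges it makes `g` at most `η`: near `θ` by differentiability of the
  -- boundary function, elsewhere by the choice of `y`. The maximum principle carries this inside.
  set g : ℂ → ℂ := fun w => Ψ w * (y * ((w - θ + y * Complex.I) ^ 2)⁻¹) with hg
  have hEd : ∀ w ∈ closedStrip q,
      DifferentiableAt ℂ (fun w => (y * ((w - θ + y * Complex.I) ^ 2)⁻¹ : ℂ)) w := by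
    intro w hw
    have h1 : DifferentiableAt ℂ (fun w : ℂ => (w - θ + y * Complex.I) ^ 2) w := by fun_prop
    exact (h1.inv (pow_ne_zero 2 (hden0 w hw))).const_mul _
  have hgd : DiffContOnCl ℂ g (strip q) := by
    refine ⟨hΨd.differentiableOn.mul fun v hv =>
      (hEd v (strip_subset_closedStrip q hv)).differentiableWithinAt, ?_⟩
    refine hΨd.continuousOn.mul fun v hv => ?_
    rw [closure_strip hq] at hv
    exact (hEd v hv).continuousAt.continuousWithinAt
  have hgn : ∀ w, ‖g w‖ = ‖Ψ w‖ * y / ‖w - θ + y * Complex.I‖ ^ 2 := by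
    intro w; rw [hg]; simp [abs_of_pos hy0]; ring
  have hgK : ∀ w ∈ closedStrip q, ∀ B : ℝ, 0 ≤ B → ‖Ψ w‖ ≤ B * ‖w - θ‖ → ‖g w‖ ≤ B := by
    intro w hw B hB h
    have h1 := hden w hw
    have h2 : 0 < ‖w - θ + y * Complex.I‖ ^ 2 := by
      have := norm_pos_iff.2 (hden0 w hw); positivity
    rw [hgn, div_le_iff₀ h2]
    calc ‖Ψ w‖ * y ≤ B * ‖w - θ‖ * y := by gcongr
      _ = B * (‖w - θ‖ * y) := by ring
      _ ≤ B * (‖w - θ‖ ^ 2 + y ^ 2) := by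
          gcongr; nlinarith [sq_nonneg (‖w - θ‖ - y), sq_nonneg ‖w - θ‖, sq_nonneg y]
      _ ≤ _ := by gcongr
  have hgfar : ∀ w ∈ closedStrip q, ρ ≤ ‖w - θ‖ → ‖g w‖ ≤ η := by
    intro w hw h
    have h1 := hden w hw
    have h2 : 0 < ‖w - θ + y * Complex.I‖ ^ 2 := by
      have := norm_pos_iff.2 (hden0 w hw); positivity
    rw [hgn, div_le_iff₀ h2]
    calc ‖Ψ w‖ * y ≤ M' * ‖w - θ‖ * y := by gcongr; exact hΨ1 w hw
      _ = y * M' * ‖w - θ‖ := by ring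
      _ ≤ η * ρ * ‖w - θ‖ := by gcongr
      _ ≤ η * ‖w - θ‖ * ‖w - θ‖ := by gcongr
      _ ≤ η * (‖w - θ‖ ^ 2 + y ^ 2) := by nlinarith [sq_nonneg y]
      _ ≤ _ := by gcongr
  have hgle : ∀ w ∈ closedStrip q, ‖g w‖ ≤ η := by
    intro w hw
    refine norm_le_of_strip hq hgd (M := M') ?_ ?_ ?_ hw
    · intro w hw
      have hw := strip_subset_closedStrip q hw
      exact hgK w hw M' hM'0.le (hΨ1 w hw)
    · intro x
      have hx : (x : ℂ) ∈ closedStrip q := by simp [closedStrip, hq.le]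
      by_cases h : ρ ≤ ‖(x : ℂ) - θ‖
      · exact hgfar _ hx h
      · push Not at h
        refine hgK _ hx η hη0.le ?_
        have h1 : dist x θ < ρ₀ := by
          rw [Real.dist_eq]
          rw [← Complex.ofReal_sub, Complex.norm_real] at h
          exact h.trans_le (min_le_left _ _)
        have h2 := hball h1
        rw [← Complex.ofReal_sub, Complex.norm_real]
        simpa [hΨ, mul_comm] using h2
    · intro x
      have hx : (x + q * Complex.I : ℂ) ∈ closedStrip q := by simp [closedStrip, hq.le]
      refine hgfar _ hx ?_
      have h1 := Complex.abs_im_le_norm (x + q * Complex.I - θ : ℂ)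
      simp [abs_of_pos hq] at h1
      exact (min_le_right _ _).trans h1
  have hsub : Metric.closedBall (θ + y * Complex.I : ℂ) (y / 2) ⊆ strip q := by
    intro w hw
    rw [Metric.mem_closedBall, dist_eq_norm] at hw
    have h1 := (Complex.abs_im_le_norm (w - (θ + y * Complex.I))).trans hw
    simp at h1
    rw [abs_le] at h1
    constructor <;> linarith [h1.1, h1.2]
  have hmem : (θ + y * Complex.I : ℂ) ∈ strip q := hsub (Metric.mem_closedBall_self (by linarith))
  have hcauchy := Complex.norm_deriv_le_of_forall_mem_sphere_norm_le (f := Ψ)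
    (c := θ + y * Complex.I) (R := y / 2) (C := 25 / 4 * η * y) (by linarith)
    (hΨd.mono (Metric.ball_subset_closedBall.trans hsub)) (by
      intro w hw
      have hw' := Metric.sphere_subset_closedBall hw
      have hws := strip_subset_closedStrip q (hsub hw')
      have h1 := hgle w hws
      have h2 : 0 < ‖w - θ + y * Complex.I‖ ^ 2 := by
        have := norm_pos_iff.2 (hden0 w hws); positivity
      rw [hgn, div_le_iff₀ h2] at h1
      have h3 : ‖w - θ + y * Complex.I‖ ≤ 5 / 2 * y := by
        have e : w - θ + y * Complex.I = (w - (θ + y * Complex.I)) + (2 * y : ℝ) * Complex.I := by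
          push_cast; ring
        rw [e]
        refine (norm_add_le _ _).trans ?_
        rw [Metric.mem_sphere, dist_eq_norm] at hw
        rw [hw, norm_mul, Complex.norm_I, Complex.norm_real, Real.norm_of_nonneg (by linarith)]
        linarith
      have h4 : ‖w - θ + y * Complex.I‖ ^ 2 ≤ (5 / 2 * y) ^ 2 := by gcongr
      have h5 : ‖Ψ w‖ * y ≤ (25 / 4 * η * y) * y := by nlinarith
      exact le_of_mul_le_mul_right h5 hy0)
  have hder : deriv Ψ (θ + y * Complex.I) = deriv Φ (θ + y * Complex.I) - a := by
    have h1 : HasDerivAt Φ (deriv Φ (θ + y * Complex.I)) (θ + y * Complex.I) :=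
      (hd.differentiableAt (isOpen_strip q) hmem).hasDerivAt
    have h2 := (h1.sub_const (Φ θ)).sub
      (((hasDerivAt_id (θ + y * Complex.I : ℂ)).sub_const (θ : ℂ)).const_mul a)
    rw [mul_one] at h2
    exact h2.deriv
  rw [hder] at hcauchy
  rw [dist_eq_norm]
  refine hcauchy.trans_lt ?_
  rw [div_lt_iff₀ (by linarith), hη]
  nlinarith

/-- A Lipschitz curve whose derivative is almost everywhere bounded by `K` is `K`-Lipschitz. -/
theorem norm_sub_le_of_ae_hasDerivAt_le {G : ℝ → ℂ} {M : NNReal} (hG : LipschitzWith M G) {K : ℝ}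
    (h : ∀ᵐ θ : ℝ, ∀ a, HasDerivAt G a θ → ‖a‖ ≤ K) (x y : ℝ) :
    ‖G x - G y‖ ≤ K * |x - y| := by
  set c := G x - G y with hc
  by_cases hc0 : c = 0
  · obtain ⟨θ, h1, h2⟩ := (h.and hG.ae_differentiableAt_real).exists
    have := (norm_nonneg _).trans (h1 _ h2.hasDerivAt)
    rw [hc0, norm_zero]; positivity
  -- Pairing with `c` itself makes the curve real-valued and loses nothing, since `ℓ c = ‖c‖²`; the
  -- fundamental theorem for absolutely continuous functions then applies.
  set ℓ : ℂ →L[ℝ] ℝ := Complex.reCLM.comp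
    ((ContinuousLinearMap.mul ℝ ℂ) ((starRingEnd ℂ) c)) with hℓ
  have hℓn : ∀ z, ‖ℓ z‖ ≤ ‖c‖ * ‖z‖ := by
    intro z
    rw [hℓ]
    simp only [ContinuousLinearMap.comp_apply, ContinuousLinearMap.mul_apply', Complex.reCLM_apply]
    refine (Complex.abs_re_le_norm _).trans ?_
    rw [norm_mul, Complex.norm_conj]
  have hLip : LipschitzWith (‖ℓ‖₊ * M) (ℓ ∘ G) := ℓ.lipschitz.comp hG
  have hac : AbsolutelyContinuousOnInterval (ℓ ∘ G) y x :=
    (hLip.lipschitzOnWith (s := Set.uIcc y x)).absolutelyContinuousOnInterval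
  have hint := hac.integral_deriv_eq_sub
  have hb : ‖∫ t in y..x, deriv (ℓ ∘ G) t‖ ≤ ‖c‖ * K * |x - y| := by
    refine intervalIntegral.norm_integral_le_of_norm_le_const_ae ?_
    filter_upwards [h, hG.ae_differentiableAt_real] with t ht htd _
    have h1 := ℓ.hasFDerivAt.comp_hasDerivAt t htd.hasDerivAt
    rw [h1.deriv]
    exact (hℓn _).trans (by gcongr; exact ht _ htd.hasDerivAt)
  rw [hint] at hb
  have e : (ℓ ∘ G) x - (ℓ ∘ G) y = ‖c‖ ^ 2 := by
    simp only [Function.comp_apply]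
    rw [← map_sub, ← hc, hℓ]
    simp only [ContinuousLinearMap.comp_apply, ContinuousLinearMap.mul_apply', Complex.reCLM_apply]
    rw [mul_comm, Complex.mul_conj, Complex.ofReal_re, Complex.normSq_eq_norm_sq]
  rw [e, Real.norm_of_nonneg (by positivity)] at hb
  have hcp := norm_pos_iff.2 hc0
  have : ‖c‖ * ‖c‖ ≤ ‖c‖ * (K * |x - y|) := by nlinarith
  exact le_of_mul_le_mul_left this hcp

/-! ### The covering strip and lifted functions -/

/-- The universal covering `w ↦ exp (i w)` of the annulus by a strip. -/
noncomputable def cover (w : ℂ) : ℂ := Complex.exp (Complex.I * w)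

theorem norm_cover (w : ℂ) : ‖cover w‖ = Real.exp (-w.im) := by
  rw [cover, Complex.norm_exp]; simp

theorem hasDerivAt_cover (w : ℂ) : HasDerivAt cover (Complex.I * cover w) w := by
  have h : HasDerivAt (fun w : ℂ => Complex.I * w) Complex.I w := by
    simpa using (hasDerivAt_id w).const_mul Complex.I
  have h2 := h.cexp
  rw [mul_comm] at h2
  exact h2

theorem continuous_cover : Continuous cover := by unfold cover; fun_prop

theorem cover_ne_zero (w : ℂ) : cover w ≠ 0 := Complex.exp_ne_zero _

theorem q0_pos {s : ℝ} (hs0 : 0 < s) (hs1 : s < 1) : 0 < q0 s := by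
  rw [q0]; linarith [Real.log_neg hs0 hs1]

theorem exp_neg_q0 {s : ℝ} (hs0 : 0 < s) : Real.exp (-q0 s) = s := by
  rw [q0, neg_neg, Real.exp_log hs0]

theorem cover_mem_annulus_iff {s : ℝ} (hs0 : 0 < s) (w : ℂ) :
    cover w ∈ annulus s ↔ w ∈ strip (q0 s) := by
  have h : s < Real.exp (-w.im) ↔ w.im < q0 s := by
    nth_rewrite 1 [← exp_neg_q0 hs0]; rw [Real.exp_lt_exp, neg_lt_neg_iff]
  rw [annulus, Set.mem_ofPred_eq, norm_cover, h, Real.exp_lt_one_iff, neg_lt_zero, and_comm]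
  rfl

theorem exists_cover_eq {z : ℂ} (hz : z ≠ 0) :
    ∃ w, cover w = z ∧ |w.re| ≤ Real.pi ∧ w.im = -Real.log ‖z‖ := by
  refine ⟨-Complex.I * Complex.log z, ?_, ?_, ?_⟩
  · rw [cover, ← mul_assoc]; simp [Complex.exp_log hz]
  · simpa [Complex.log_im] using Complex.abs_arg_le_pi z
  · simp [Complex.log_re]

theorem isOpen_annulus (s : ℝ) : IsOpen (annulus s) :=
  (isOpen_lt continuous_const continuous_norm).inter (isOpen_lt continuous_norm continuous_const)

theorem ne_zero_of_mem_annulus {s : ℝ} (hs0 : 0 < s) {z : ℂ} (hz : z ∈ annulus s) : z ≠ 0 :=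
  norm_pos_iff.1 (hs0.trans hz.1)

theorem cover_ofReal (θ : ℝ) : cover θ = circleMap 0 1 θ := by
  simp [cover, circleMap_zero, mul_comm]

theorem cover_ofReal_add_q0 {s : ℝ} (hs0 : 0 < s) (θ : ℝ) :
    cover (θ + q0 s * Complex.I) = circleMap 0 s θ := by
  have h : (Complex.exp (-(q0 s : ℂ)) : ℂ) = s := by
    rw [← Complex.ofReal_neg, ← Complex.ofReal_exp, exp_neg_q0 hs0]
  rw [circleMap_zero, ← h, ← Complex.exp_add, cover]
  congr 1
  linear_combination (q0 s : ℂ) * Complex.I_mul_I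

theorem convex_strip (q : ℝ) : Convex ℝ (strip q) :=
  (convex_Ioo 0 q).linear_preimage Complex.imLm

/-- The function `f (exp (i w))` on the strip, extended by continuity to the closed strip. -/
noncomputable def lift (s : ℝ) (f : ℂ → ℂ) : ℂ → ℂ := extendFrom (strip (q0 s)) fun w => f (cover w)

section Lift

variable {s : ℝ} {f : ℂ → ℂ} {M : ℝ}

theorem hasDerivAt_comp_cover (hs0 : 0 < s) (hf : DifferentiableOn ℂ f (annulus s)) {w : ℂ}
    (hw : w ∈ strip (q0 s)) :
    HasDerivAt (fun w => f (cover w)) (deriv f (cover w) * (Complex.I * cover w)) w := by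
  have h := (hf.differentiableAt
    ((isOpen_annulus s).mem_nhds ((cover_mem_annulus_iff hs0 w).2 hw))).hasDerivAt
  exact h.comp w (hasDerivAt_cover w)

theorem lift_eq (hs0 : 0 < s) (hf : DifferentiableOn ℂ f (annulus s)) {w : ℂ}
    (hw : w ∈ strip (q0 s)) : lift s f w = f (cover w) :=
  extendFrom_extends (fun _ hw =>
    (hasDerivAt_comp_cover hs0 hf hw).continuousAt.continuousWithinAt) _ hw

theorem hasDerivAt_lift (hs0 : 0 < s) (hf : DifferentiableOn ℂ f (annulus s)) {w : ℂ}
    (hw : w ∈ strip (q0 s)) :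
    HasDerivAt (lift s f) (deriv f (cover w) * (Complex.I * cover w)) w := by
  refine (hasDerivAt_comp_cover hs0 hf hw).congr_of_eventuallyEq ?_
  filter_upwards [(isOpen_strip _).mem_nhds hw] with v hv using lift_eq hs0 hf hv

/-- The strip is convex, unlike the annulus, so a derivative bound integrates directly. The constant
`M` survives because the chain rule only contributes a factor `|z| < 1`. -/
theorem lipschitzOnWith_comp_cover (hs0 : 0 < s) (hf : DifferentiableOn ℂ f (annulus s))
    (hM : ∀ z ∈ annulus s, ‖deriv f z‖ ≤ M) :
    LipschitzOnWith M.toNNReal (fun w => f (cover w)) (strip (q0 s)) := by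
  refine (convex_strip _).lipschitzOnWith_of_nnnorm_hasDerivWithin_le
    (fun w hw => (hasDerivAt_comp_cover hs0 hf hw).hasDerivWithinAt) fun w hw => ?_
  rw [← NNReal.coe_le_coe, coe_nnnorm]
  refine le_trans ?_ (Real.le_coe_toNNReal M)
  have h1 := (cover_mem_annulus_iff hs0 w).2 hw
  rw [norm_mul, norm_mul, Complex.norm_I, one_mul]
  calc _ ≤ M * 1 := mul_le_mul (hM _ h1) h1.2.le (norm_nonneg _) ((norm_nonneg _).trans (hM _ h1))
    _ = M := mul_one M

theorem exists_tendsto_comp_cover (hs0 : 0 < s) (hs1 : s < 1)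
    (hf : DifferentiableOn ℂ f (annulus s))
    (hM : ∀ z ∈ annulus s, ‖deriv f z‖ ≤ M) {w : ℂ} (hw : w ∈ closedStrip (q0 s)) :
    ∃ y, Tendsto (fun w => f (cover w)) (𝓝[strip (q0 s)] w) (𝓝 y) := by
  rw [← closure_strip (q0_pos hs0 hs1), mem_closure_iff_nhdsWithin_neBot] at hw
  exact CompleteSpace.complete (((cauchy_nhds (a := w)).mono nhdsWithin_le_nhds).map_of_le
    (lipschitzOnWith_comp_cover hs0 hf hM).uniformContinuousOn inf_le_right)

theorem tendsto_comp_cover (hs0 : 0 < s) (hs1 : s < 1)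
    (hf : DifferentiableOn ℂ f (annulus s))
    (hM : ∀ z ∈ annulus s, ‖deriv f z‖ ≤ M) {w : ℂ} (hw : w ∈ closedStrip (q0 s)) :
    Tendsto (fun w => f (cover w)) (𝓝[strip (q0 s)] w) (𝓝 (lift s f w)) :=
  tendsto_extendFrom (exists_tendsto_comp_cover hs0 hs1 hf hM hw)

theorem continuousOn_lift (hs0 : 0 < s) (hs1 : s < 1) (hf : DifferentiableOn ℂ f (annulus s))
    (hM : ∀ z ∈ annulus s, ‖deriv f z‖ ≤ M) : ContinuousOn (lift s f) (closedStrip (q0 s)) :=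
  continuousOn_extendFrom (closure_strip (q0_pos hs0 hs1)).ge
    fun _ hw => exists_tendsto_comp_cover hs0 hs1 hf hM hw

theorem diffContOnCl_lift (hs0 : 0 < s) (hs1 : s < 1) (hf : DifferentiableOn ℂ f (annulus s))
    (hM : ∀ z ∈ annulus s, ‖deriv f z‖ ≤ M) : DiffContOnCl ℂ (lift s f) (strip (q0 s)) := by
  refine ⟨fun w hw => (hasDerivAt_lift hs0 hf hw).differentiableAt.differentiableWithinAt, ?_⟩
  rw [closure_strip (q0_pos hs0 hs1)]
  exact continuousOn_lift hs0 hs1 hf hM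

theorem norm_lift_sub_le (hs0 : 0 < s) (hs1 : s < 1) (hf : DifferentiableOn ℂ f (annulus s))
    (hM : ∀ z ∈ annulus s, ‖deriv f z‖ ≤ M) (hM0 : 0 ≤ M) {v w : ℂ}
    (hv : v ∈ closedStrip (q0 s)) (hw : w ∈ closedStrip (q0 s)) :
    ‖lift s f v - lift s f w‖ ≤ M * ‖v - w‖ := by
  have h1 := tendsto_comp_cover hs0 hs1 hf hM hv
  have h2 := tendsto_comp_cover hs0 hs1 hf hM hw
  rw [← closure_strip (q0_pos hs0 hs1), mem_closure_iff_nhdsWithin_neBot] at hv hw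
  have h3 : Tendsto (fun p : ℂ × ℂ => ‖f (cover p.1) - f (cover p.2)‖)
      (𝓝[strip (q0 s)] v ×ˢ 𝓝[strip (q0 s)] w) (𝓝 ‖lift s f v - lift s f w‖) :=
    ((h1.comp tendsto_fst).sub (h2.comp tendsto_snd)).norm
  have h4 : Tendsto (fun p : ℂ × ℂ => M * ‖p.1 - p.2‖)
      (𝓝[strip (q0 s)] v ×ˢ 𝓝[strip (q0 s)] w) (𝓝 (M * ‖v - w‖)) :=
    (((tendsto_id.mono_left nhdsWithin_le_nhds).comp tendsto_fst).sub
      ((tendsto_id.mono_left nhdsWithin_le_nhds).comp tendsto_snd)).norm.const_mul M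
  refine le_of_tendsto_of_tendsto h3 h4 ?_
  filter_upwards [prod_mem_prod self_mem_nhdsWithin self_mem_nhdsWithin] with p hp
  have := (lipschitzOnWith_comp_cover hs0 hf hM).dist_le_mul _ hp.1 _ hp.2
  rwa [dist_eq_norm, dist_eq_norm, Real.coe_toNNReal _ hM0] at this

end Lift

/-! ### Radial limits and the maximum principle on the annulus -/

section BoundaryValue

variable {s : ℝ}

/-- A radius becomes a vertical line under the covering, with `y = -log r`. The approach set
contains `(s, 1)`, so the filter is nontrivial and the limit is unique. -/
theorem bdryValue_outer_eq (hs0 : 0 < s) (hs1 : s < 1) {g : ℂ → ℂ} {θ : ℝ} {a : ℂ}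
    (h : Tendsto (fun y : ℝ => g (cover (θ + y * Complex.I))) (𝓝[>] 0) (𝓝 a)) :
    bdryValue s g (circleMap 0 1 θ) = a := by
  have hn : ∀ r : ℝ, 0 < r → (r : ℂ) * circleMap 0 1 θ = cover (θ + (-Real.log r : ℝ) * Complex.I) := by
    intro r hr
    have h1 : (r : ℂ) = Complex.exp (Real.log r : ℝ) := by
      rw [← Complex.ofReal_exp, Real.exp_log hr]
    rw [← cover_ofReal, cover, cover, h1, ← Complex.exp_add]
    congr 1
    push_cast
    linear_combination (Real.log r : ℂ) * Complex.I_mul_I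
  set A : Set ℝ := {r : ℝ | (r : ℂ) * circleMap 0 1 θ ∈ annulus s} with hA
  have hsub : Set.Ioo s 1 ⊆ A := by
    intro r hr
    have hr0 := hs0.trans hr.1
    simp only [hA, annulus, Set.mem_ofPred_eq, norm_mul, norm_circleMap_zero, Complex.norm_real,
      abs_one, mul_one, Real.norm_of_nonneg hr0.le]
    exact hr
  have hne : (𝓝[A] (1 : ℝ)).NeBot := by
    have : (𝓝[Set.Ioo s 1] (1 : ℝ)).NeBot := right_nhdsWithin_Ioo_neBot hs1
    exact this.mono (nhdsWithin_mono _ hsub)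
  have hpos : ∀ᶠ r in 𝓝[A] (1 : ℝ), 0 < r :=
    nhdsWithin_le_nhds (Ioi_mem_nhds one_pos)
  have hlog : Tendsto (fun r => -Real.log r) (𝓝[A] 1) (𝓝[>] 0) := by
    refine tendsto_nhdsWithin_iff.2 ⟨?_, ?_⟩
    · have := ((Real.continuousAt_log one_ne_zero).tendsto.neg).mono_left
        (nhdsWithin_le_nhds (s := A))
      simpa using this
    · filter_upwards [hpos, self_mem_nhdsWithin] with r hr hrA
      simp only [hA, annulus, Set.mem_ofPred_eq, norm_mul, norm_circleMap_zero, Complex.norm_real,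
        abs_one, mul_one, Real.norm_of_nonneg hr.le] at hrA
      simpa using Real.log_neg hr hrA.2
  refine Tendsto.limUnder_eq ((h.comp hlog).congr' ?_)
  filter_upwards [hpos] with r hr
  simp only [Function.comp_apply, hn r hr]

/-- On the inner circle `r` decreases to `1` and `y = log r`. The point is written through the
half-turn `w ↦ i q₀ - w`, which swaps the two edges, so that results about the lower edge apply. -/
theorem bdryValue_inner_eq (hs0 : 0 < s) (hs1 : s < 1) {g : ℂ → ℂ} {θ : ℝ} {a : ℂ}
    (h : Tendsto (fun y : ℝ => g (cover (q0 s * Complex.I - (-θ + y * Complex.I)))) (𝓝[>] 0) (𝓝 a)) :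
    bdryValue s g (circleMap 0 s θ) = a := by
  have hn : ∀ r : ℝ, 0 < r → (r : ℂ) * circleMap 0 s θ =
      cover (q0 s * Complex.I - (-θ + (Real.log r : ℝ) * Complex.I)) := by
    intro r hr
    have h1 : (r : ℂ) = Complex.exp (Real.log r : ℝ) := by
      rw [← Complex.ofReal_exp, Real.exp_log hr]
    rw [← cover_ofReal_add_q0 hs0, cover, cover, h1, ← Complex.exp_add]
    congr 1
    linear_combination (Real.log r : ℂ) * Complex.I_mul_I
  set A : Set ℝ := {r : ℝ | (r : ℂ) * circleMap 0 s θ ∈ annulus s} with hA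
  have hsub : Set.Ioo 1 s⁻¹ ⊆ A := by
    intro r hr
    have hr0 := one_pos.trans hr.1
    simp only [hA, annulus, Set.mem_ofPred_eq, norm_mul, norm_circleMap_zero, Complex.norm_real,
      abs_of_pos hs0, Real.norm_of_nonneg hr0.le]
    refine ⟨by nlinarith [hr.1], ?_⟩
    calc r * s < s⁻¹ * s := by gcongr; exact hr.2
      _ = 1 := inv_mul_cancel₀ hs0.ne'
  have hne : (𝓝[A] (1 : ℝ)).NeBot := by
    have : (𝓝[Set.Ioo 1 s⁻¹] (1 : ℝ)).NeBot :=
      left_nhdsWithin_Ioo_neBot ((one_lt_inv₀ hs0).2 hs1)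
    exact this.mono (nhdsWithin_mono _ hsub)
  have hpos : ∀ᶠ r in 𝓝[A] (1 : ℝ), 0 < r :=
    nhdsWithin_le_nhds (Ioi_mem_nhds one_pos)
  have hlog : Tendsto (fun r => Real.log r) (𝓝[A] 1) (𝓝[>] 0) := by
    refine tendsto_nhdsWithin_iff.2 ⟨?_, ?_⟩
    · have := ((Real.continuousAt_log one_ne_zero).tendsto).mono_left
        (nhdsWithin_le_nhds (s := A))
      simpa using this
    · filter_upwards [hpos, self_mem_nhdsWithin] with r hr hrA
      simp only [hA, annulus, Set.mem_ofPred_eq, norm_mul, norm_circleMap_zero, Complex.norm_real,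
        abs_of_pos hs0, Real.norm_of_nonneg hr.le] at hrA
      exact Real.log_pos (by nlinarith [hrA.1])
  refine Tendsto.limUnder_eq ((h.comp hlog).congr' ?_)
  filter_upwards [hpos] with r hr
  simp only [Function.comp_apply, hn r hr]

variable {f : ℂ → ℂ} {M : ℝ}

theorem tendsto_vertical {q : ℝ} (hq : 0 < q) (θ : ℝ) :
    Tendsto (fun y : ℝ => (θ + y * Complex.I : ℂ)) (𝓝[>] 0) (𝓝[strip q] θ) := by
  refine tendsto_nhdsWithin_iff.2 ⟨?_, ?_⟩
  · have : Continuous fun y : ℝ => (θ + y * Complex.I : ℂ) := by fun_prop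
    simpa using (this.tendsto 0).mono_left nhdsWithin_le_nhds
  · filter_upwards [Ioo_mem_nhdsGT hq] with y hy
    simpa [strip] using hy

theorem flip_mem_strip_iff {q : ℝ} {w : ℂ} : (q * Complex.I - w) ∈ strip q ↔ w ∈ strip q := by
  simp [strip, and_comm]

theorem flip_mem_closedStrip_iff {q : ℝ} {w : ℂ} :
    (q * Complex.I - w) ∈ closedStrip q ↔ w ∈ closedStrip q := by
  simp [closedStrip, and_comm]

theorem ofReal_mem_closedStrip {q : ℝ} (hq : 0 ≤ q) (x : ℝ) : (x : ℂ) ∈ closedStrip q := by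
  simp [closedStrip, hq]

theorem ofReal_add_mem_closedStrip {q : ℝ} (hq : 0 ≤ q) (x : ℝ) :
    (x + q * Complex.I : ℂ) ∈ closedStrip q := by
  simp [closedStrip, hq]

theorem DiffContOnCl.flip {q : ℝ} {Φ : ℂ → ℂ} (h : DiffContOnCl ℂ Φ (strip q)) :
    DiffContOnCl ℂ (fun w => Φ (q * Complex.I - w)) (strip q) := by
  have h1 : Differentiable ℂ fun w : ℂ => q * Complex.I - w := by fun_prop
  exact h.comp h1.diffContOnCl fun w hw => flip_mem_strip_iff.2 hw

theorem DiffContOnCl.translate {q : ℝ} {Φ : ℂ → ℂ} (h : DiffContOnCl ℂ Φ (strip q))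
    (t : ℝ) : DiffContOnCl ℂ (fun w => Φ (w + t)) (strip q) := by
  have h1 : Differentiable ℂ fun w : ℂ => w + t := by fun_prop
  exact h.comp h1.diffContOnCl fun w hw => by simpa [strip] using hw

theorem bdryValue_outer (hs0 : 0 < s) (hs1 : s < 1) (hf : DifferentiableOn ℂ f (annulus s))
    (hM : ∀ z ∈ annulus s, ‖deriv f z‖ ≤ M) (θ : ℝ) :
    bdryValue s f (circleMap 0 1 θ) = lift s f θ := by
  have hq := q0_pos hs0 hs1
  exact bdryValue_outer_eq hs0 hs1 ((tendsto_comp_cover hs0 hs1 hf hM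
    (ofReal_mem_closedStrip hq.le θ)).comp (tendsto_vertical hq θ))

theorem bdryValue_inner (hs0 : 0 < s) (hs1 : s < 1) (hf : DifferentiableOn ℂ f (annulus s))
    (hM : ∀ z ∈ annulus s, ‖deriv f z‖ ≤ M) (θ : ℝ) :
    bdryValue s f (circleMap 0 s θ) = lift s f (θ + q0 s * Complex.I) := by
  have hq := q0_pos hs0 hs1
  have h1 : Tendsto (fun y : ℝ => q0 s * Complex.I - (-θ + y * Complex.I)) (𝓝[>] 0)
      (𝓝[strip (q0 s)] (θ + q0 s * Complex.I)) := by
    have h2 := tendsto_nhdsWithin_iff.1 (tendsto_vertical hq (-θ))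
    refine tendsto_nhdsWithin_iff.2 ⟨?_, ?_⟩
    · have := h2.1.const_sub (q0 s * Complex.I)
      convert this using 2
      · push_cast; ring
      · push_cast; ring
    · filter_upwards [h2.2] with y hy
      rw [flip_mem_strip_iff]; simpa using hy
  exact bdryValue_inner_eq hs0 hs1 ((tendsto_comp_cover hs0 hs1 hf hM
    (ofReal_add_mem_closedStrip hq.le θ)).comp h1)

/-- The maximum principle on the annulus, in terms of the boundary values. -/
theorem norm_lift_le (hs0 : 0 < s) (hs1 : s < 1) (hf : DifferentiableOn ℂ f (annulus s))
    {B : ℝ} (hB : ∀ z ∈ annulus s, ‖f z‖ ≤ B)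
    (hM : ∀ z ∈ annulus s, ‖deriv f z‖ ≤ M) {K : ℝ}
    (h1 : ∀ᵐ θ : ℝ, ‖bdryValue s f (circleMap 0 1 θ)‖ ≤ K)
    (h2 : ∀ᵐ θ : ℝ, ‖bdryValue s f (circleMap 0 s θ)‖ ≤ K) {w : ℂ}
    (hw : w ∈ closedStrip (q0 s)) : ‖lift s f w‖ ≤ K := by
  have hq := q0_pos hs0 hs1
  have hc := continuousOn_lift hs0 hs1 hf hM
  -- A set of full measure is dense, so continuity upgrades the almost everywhere bound to every
  -- point.
  have key : ∀ φ : ℝ → ℂ, Continuous φ → (∀ᵐ θ : ℝ, ‖φ θ‖ ≤ K) → ∀ θ, ‖φ θ‖ ≤ K := by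
    intro φ hφ h
    have hd : Dense {θ | ‖φ θ‖ ≤ K} := Measure.dense_of_ae h
    have hcl : IsClosed {θ | ‖φ θ‖ ≤ K} := isClosed_le hφ.norm continuous_const
    intro θ
    have := hd θ
    rwa [hcl.closure_eq] at this
  refine norm_le_of_strip hq (diffContOnCl_lift hs0 hs1 hf hM) (M := B) ?_ ?_ ?_ hw
  · intro w hw
    rw [lift_eq hs0 hf hw]
    exact hB _ ((cover_mem_annulus_iff hs0 w).2 hw)
  · refine key (fun θ => lift s f θ) ?_ ?_
    · exact hc.comp_continuous Complex.continuous_ofReal (ofReal_mem_closedStrip hq.le)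
    · simpa only [bdryValue_outer hs0 hs1 hf hM] using h1
  · refine key (fun θ => lift s f (θ + q0 s * Complex.I)) ?_ ?_
    · exact hc.comp_continuous (by fun_prop) (ofReal_add_mem_closedStrip hq.le)
    · simpa only [bdryValue_inner hs0 hs1 hf hM] using h2

/-- If the boundary values of `f'` are bounded by `K`, then `|f'| ≤ K / s` in the annulus. -/
theorem norm_deriv_le_of_bdryValue (hs0 : 0 < s) (hs1 : s < 1)
    (hf : DifferentiableOn ℂ f (annulus s))
    (hM : ∀ z ∈ annulus s, ‖deriv f z‖ ≤ M) {K : ℝ}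
    (h1 : ∀ᵐ θ : ℝ, ‖bdryValue s (deriv f) (circleMap 0 1 θ)‖ ≤ K)
    (h2 : ∀ᵐ θ : ℝ, ‖bdryValue s (deriv f) (circleMap 0 s θ)‖ ≤ K) {z : ℂ}
    (hz : z ∈ annulus s) : ‖deriv f z‖ ≤ K / s := by
  have hq := q0_pos hs0 hs1
  have hM0 : 0 ≤ M := (norm_nonneg _).trans (hM z hz)
  have hK0 : 0 ≤ K := by
    obtain ⟨θ, hθ⟩ := h1.exists
    exact (norm_nonneg _).trans hθ
  have hd := diffContOnCl_lift hs0 hs1 hf hM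
  have hLip : ∀ v ∈ closedStrip (q0 s), ∀ w ∈ closedStrip (q0 s),
      ‖lift s f v - lift s f w‖ ≤ M * ‖v - w‖ := fun v hv w hw =>
    norm_lift_sub_le hs0 hs1 hf hM hM0 hv hw
  -- tangential derivatives on the two edges
  have hout : ∀ x y : ℝ, ‖lift s f x - lift s f y‖ ≤ K * |x - y| := by
    have hLG : LipschitzWith M.toNNReal fun x : ℝ => lift s f x := by
      refine LipschitzWith.of_dist_le_mul fun x y => ?_
      rw [Real.coe_toNNReal _ hM0, dist_eq_norm]
      refine (hLip _ (ofReal_mem_closedStrip hq.le x) _ (ofReal_mem_closedStrip hq.le y)).trans ?_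
      rw [← Complex.ofReal_sub, Complex.norm_real, dist_eq_norm]
    refine norm_sub_le_of_ae_hasDerivAt_le hLG ?_
    filter_upwards [h1] with θ hθ a ha
    have ht := tendsto_deriv_of_hasDerivAt_edge hq hd hLip ha
    have hv := tendsto_vertical hq θ
    have hcov : Tendsto (fun y : ℝ => (Complex.I * cover (θ + y * Complex.I))⁻¹) (𝓝[>] 0)
        (𝓝 (Complex.I * cover θ)⁻¹) := by
      refine Tendsto.inv₀ ?_ (mul_ne_zero Complex.I_ne_zero (cover_ne_zero _))
      exact ((continuous_cover.tendsto _).comp (hv.mono_right nhdsWithin_le_nhds)).const_mul _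
    have hlim : Tendsto (fun y : ℝ => deriv f (cover (θ + y * Complex.I))) (𝓝[>] 0)
        (𝓝 (a * (Complex.I * cover θ)⁻¹)) := by
      refine (ht.mul hcov).congr' ?_
      filter_upwards [(tendsto_nhdsWithin_iff.1 hv).2] with y hy
      rw [(hasDerivAt_lift hs0 hf hy).deriv, mul_assoc, mul_inv_cancel₀, mul_one]
      exact mul_ne_zero Complex.I_ne_zero (cover_ne_zero _)
    rw [bdryValue_outer_eq hs0 hs1 hlim] at hθ
    simpa [norm_cover] using hθ
  have hin : ∀ x y : ℝ, ‖lift s f (q0 s * Complex.I - x) - lift s f (q0 s * Complex.I - y)‖ ≤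
      K * |x - y| := by
    have hLip' : ∀ v ∈ closedStrip (q0 s), ∀ w ∈ closedStrip (q0 s),
        ‖lift s f (q0 s * Complex.I - v) - lift s f (q0 s * Complex.I - w)‖ ≤ M * ‖v - w‖ := by
      intro v hv w hw
      refine (hLip _ (flip_mem_closedStrip_iff.2 hv) _ (flip_mem_closedStrip_iff.2 hw)).trans ?_
      rw [sub_sub_sub_cancel_left, norm_sub_rev]
    have hLG : LipschitzWith M.toNNReal fun x : ℝ => lift s f (q0 s * Complex.I - x) := by
      refine LipschitzWith.of_dist_le_mul fun x y => ?_
      rw [Real.coe_toNNReal _ hM0, dist_eq_norm]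
      refine (hLip' _ (ofReal_mem_closedStrip hq.le x) _ (ofReal_mem_closedStrip hq.le y)).trans ?_
      rw [← Complex.ofReal_sub, Complex.norm_real, dist_eq_norm]
    refine norm_sub_le_of_ae_hasDerivAt_le hLG ?_
    -- The half-turn reverses the angle, hence the reflection of the null set.
    have h2' := (Measure.measurePreserving_neg (volume : Measure ℝ)).quasiMeasurePreserving.ae h2
    filter_upwards [h2'] with θ hθ a ha
    have ht := tendsto_deriv_of_hasDerivAt_edge hq (DiffContOnCl.flip hd) hLip' ha
    have hv := tendsto_vertical hq θ
    have hcov : Tendsto (fun y : ℝ => -(Complex.I * cover (q0 s * Complex.I - (θ + y * Complex.I)))⁻¹)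
        (𝓝[>] 0) (𝓝 (-(Complex.I * cover (q0 s * Complex.I - θ))⁻¹)) := by
      refine (Tendsto.inv₀ ?_ (mul_ne_zero Complex.I_ne_zero (cover_ne_zero _))).neg
      exact ((continuous_cover.tendsto _).comp
        ((hv.mono_right nhdsWithin_le_nhds).const_sub _)).const_mul _
    have hlim : Tendsto (fun y : ℝ => deriv f (cover (q0 s * Complex.I - (-(-θ : ℝ) + y * Complex.I))))
        (𝓝[>] 0) (𝓝 (a * -(Complex.I * cover (q0 s * Complex.I - θ))⁻¹)) := by
      refine (ht.mul hcov).congr' ?_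
      filter_upwards [(tendsto_nhdsWithin_iff.1 hv).2] with y hy
      have h3 := (hasDerivAt_lift hs0 hf (flip_mem_strip_iff.2 hy)).comp (θ + y * Complex.I : ℂ)
        ((hasDerivAt_id _).const_sub (q0 s * Complex.I))
      have h4 : deriv (fun w => lift s f (q0 s * Complex.I - w)) (θ + y * Complex.I) = _ := h3.deriv
      have h5 := mul_ne_zero Complex.I_ne_zero (cover_ne_zero (q0 s * Complex.I - (θ + y * Complex.I)))
      rw [h4]
      push_cast
      rw [neg_neg]
      rw [mul_neg_one, neg_mul_neg, mul_assoc, mul_inv_cancel₀ h5, mul_one]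
    rw [bdryValue_inner_eq hs0 hs1 hlim] at hθ
    have hcs : ‖cover (q0 s * Complex.I - θ)‖ = s := by
      rw [norm_cover]; simp [exp_neg_q0 hs0]
    rw [norm_mul, norm_neg, norm_inv, norm_mul, Complex.norm_I, one_mul, hcs,
      ← div_eq_mul_inv, div_le_iff₀ hs0] at hθ
    exact hθ.trans (by nlinarith)
  -- difference quotients in the interior
  have hdiff : ∀ t : ℝ, ∀ w ∈ closedStrip (q0 s), ‖lift s f (w + t) - lift s f w‖ ≤ K * |t| := by
    intro t w hw
    have hmem : ∀ w : ℂ, w ∈ closedStrip (q0 s) → w + t ∈ closedStrip (q0 s) := by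
      intro w hw; simpa [closedStrip] using hw
    refine norm_le_of_strip (Φ := fun w => lift s f (w + t) - lift s f w) hq
      ((DiffContOnCl.translate hd t).sub hd) (M := M * |t|) ?_ ?_ ?_ hw
    · intro w hw
      have hw := strip_subset_closedStrip _ hw
      refine (hLip _ (hmem w hw) _ hw).trans ?_
      simp
    · intro x
      have := hout (x + t) x
      simpa using this
    · intro x
      have := hin (-x - t) (-x)
      have e1 : (q0 s * Complex.I - ((-x - t : ℝ) : ℂ)) = x + q0 s * Complex.I + t := by
        push_cast; ring
      have e2 : (q0 s * Complex.I - ((-x : ℝ) : ℂ)) = x + q0 s * Complex.I := by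
        push_cast; ring
      have e3 : |-x - t - -x| = |t| := by rw [← abs_neg t]; congr 1; ring
      rwa [e1, e2, e3] at this
  obtain ⟨w, hw, -, -⟩ := exists_cover_eq (ne_zero_of_mem_annulus hs0 hz)
  subst hw
  have hws := (cover_mem_annulus_iff hs0 w).1 hz
  have hder : HasDerivAt (fun t : ℝ => lift s f (w + t)) (deriv f (cover w) * (Complex.I * cover w)) 0 := by
    have h3 : HasDerivAt (fun t : ℝ => w + (t : ℂ)) 1 0 := by
      simpa using (Complex.ofRealCLM.hasDerivAt (x := 0)).const_add w
    have h4 := hasDerivAt_lift hs0 hf hws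
    have h5 : HasDerivAt (lift s f) (deriv f (cover w) * (Complex.I * cover w))
        (w + ((0 : ℝ) : ℂ)) := by simpa using h4
    have h6 := h5.scomp (0 : ℝ) h3
    rwa [one_smul] at h6
  have hle := hder.le_of_lip' hK0 (Eventually.of_forall fun t => by
    simpa using hdiff t w (strip_subset_closedStrip _ hws))
  rw [norm_mul, norm_mul, Complex.norm_I, one_mul] at hle
  -- The derivative of the lift is `f'(z) · i z`; dividing by `|z| > s` produces the `1 / s`.
  rw [le_div_iff₀ hs0]
  refine le_trans ?_ hle
  gcongr
  exact hz.1.le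

end BoundaryValue

/-! ### Essential suprema on the circles and interior bounds -/

theorem circleMeasure_le_bdryMeasure {s r : ℝ} (hr : r = s ∨ r = 1) :
    circleMeasure r ≤ bdryMeasure s := by
  rcases hr with rfl | rfl
  · exact Measure.le_add_right le_rfl
  · exact Measure.le_add_left le_rfl

theorem sphere_subset_bdry {s r : ℝ} (hr : r = s ∨ r = 1) : Metric.sphere (0 : ℂ) r ⊆ bdry s := by
  rcases hr with rfl | rfl
  · exact Set.subset_union_left
  · exact Set.subset_union_right

theorem isCompact_bdry (s : ℝ) : IsCompact (bdry s) :=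
  (isCompact_sphere 0 s).union (isCompact_sphere 0 1)

/-- A property of the points of a circle that holds almost everywhere on a period holds almost
everywhere. -/
theorem ae_circleMap_of_ae_restrict {r : ℝ} {P : ℂ → Prop}
    (h : ∀ᵐ θ : ℝ, θ ∈ Set.Ioc 0 (2 * Real.pi) → P (circleMap 0 r θ)) :
    ∀ᵐ θ : ℝ, P (circleMap 0 r θ) := by
  have h1 : ∀ n : ℤ, ∀ᵐ θ : ℝ, θ + n * (2 * Real.pi) ∈ Set.Ioc 0 (2 * Real.pi) →
      P (circleMap 0 r (θ + n * (2 * Real.pi))) := fun n =>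
    (measurePreserving_add_right volume ((n : ℝ) * (2 * Real.pi))).quasiMeasurePreserving.ae h
  filter_upwards [ae_all_iff.2 h1] with θ hθ
  obtain ⟨n, hn, -⟩ := existsUnique_add_zsmul_mem_Ioc Real.two_pi_pos θ 0
  rw [zero_add, zsmul_eq_mul] at hn
  have := hθ n hn
  rwa [(periodic_circleMap 0 r).int_mul n θ] at this

theorem ae_norm_bdryValue_le {s r : ℝ} (hr0 : 0 ≤ r) (hr : r = s ∨ r = 1) {g : ℂ → ℂ} {K : ℝ}
    (hK : 0 ≤ K) (h : supNorm s (bdry s ∩ Metric.sphere 0 r) g ≤ ENNReal.ofReal K) :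
    ∀ᵐ θ : ℝ, ‖bdryValue s g (circleMap 0 r θ)‖ ≤ K := by
  apply ae_circleMap_of_ae_restrict (P := fun ζ => ‖bdryValue s g ζ‖ ≤ K)
  rw [Set.inter_eq_right.2 (sphere_subset_bdry hr), supNorm, eLpNorm_exponent_top] at h
  have h1 : ∀ᵐ ζ ∂((bdryMeasure s).restrict (Metric.sphere 0 r)), ‖bdryValue s g ζ‖ ≤ K := by
    filter_upwards [ae_le_eLpNormEssSup (f := bdryValue s g)
      (μ := (bdryMeasure s).restrict (Metric.sphere 0 r))] with ζ hζ
    have h2 := hζ.trans h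
    rwa [← ofReal_norm, ENNReal.ofReal_le_ofReal_iff hK] at h2
  rw [ae_restrict_iff' Metric.isClosed_sphere.measurableSet] at h1
  have h2 := ae_of_ae_map (measurable_circleMap 0 r).aemeasurable
    (ae_mono (circleMeasure_le_bdryMeasure hr) h1)
  have hc : ENNReal.ofReal (1 / (2 * Real.pi)) ≠ 0 := by
    rw [Ne, ENNReal.ofReal_eq_zero, not_le]; have := Real.pi_pos; positivity
  rw [Measure.ae_ennreal_smul_measure_iff hc, ae_restrict_iff' measurableSet_Ioc] at h2
  filter_upwards [h2] with θ hθ hθ'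
  exact hθ hθ' (circleMap_mem_sphere 0 hr0 θ)

theorem supNorm_sphere_le {s r : ℝ} (hr0 : 0 ≤ r) (hr : r = s ∨ r = 1) {g : ℂ → ℂ} {B : ℝ}
    (h : ∀ θ : ℝ, ‖bdryValue s g (circleMap 0 r θ)‖ ≤ B) :
    supNorm s (bdry s ∩ Metric.sphere 0 r) g ≤ ENNReal.ofReal B := by
  rw [Set.inter_eq_right.2 (sphere_subset_bdry hr), supNorm, eLpNorm_exponent_top]
  refine eLpNormEssSup_le_of_ae_bound ?_
  rw [ae_restrict_iff' Metric.isClosed_sphere.measurableSet]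
  refine Eventually.of_forall fun ζ hζ => ?_
  have hζ' : ζ ∈ Set.range (circleMap 0 r) := by
    rw [range_circleMap, abs_of_nonneg hr0]; exact hζ
  obtain ⟨θ, rfl⟩ := hζ'
  exact h θ

section Sobolev

variable {s : ℝ} {k : ℕ} {f : ℂ → ℂ} {K : ℝ}

theorem MemHardySobolev.exists_deriv_bound (hf : MemHardySobolev s k f) {i : ℕ} (hi : i < k) :
    ∃ M, ∀ z ∈ annulus s, ‖deriv (iteratedDeriv i f) z‖ ≤ M := by
  have := (hf (i + 1) hi).2
  rwa [iteratedDeriv_succ] at this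

theorem ae_norm_iteratedDeriv_le (hs0 : 0 < s) (hK : 0 ≤ K)
    (hfK : hardySobolevNorm s k (bdry s) f ≤ ENNReal.ofReal K) {i : ℕ} (hi : i ≤ k) :
    (∀ᵐ θ : ℝ, ‖bdryValue s (iteratedDeriv i f) (circleMap 0 1 θ)‖ ≤ K) ∧
      ∀ᵐ θ : ℝ, ‖bdryValue s (iteratedDeriv i f) (circleMap 0 s θ)‖ ≤ K := by
  have h := Finset.sup_le_iff.1 hfK i (Finset.mem_range.2 (Nat.lt_succ_of_le hi))
  exact ⟨ae_norm_bdryValue_le zero_le_one (Or.inr rfl) hK (le_add_self.trans h),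
    ae_norm_bdryValue_le hs0.le (Or.inl rfl) hK (le_self_add.trans h)⟩

/-- The derivatives of `f` are bounded in the annulus in terms of its Hardy–Sobolev norm. -/
theorem norm_iteratedDeriv_le (hs0 : 0 < s) (hs1 : s < 1) (hK : 0 ≤ K)
    (hf : MemHardySobolev s k f) (hfK : hardySobolevNorm s k (bdry s) f ≤ ENNReal.ofReal K)
    (hk : 0 < k) {i : ℕ} (hi : i ≤ k) {z : ℂ} (hz : z ∈ annulus s) :
    ‖iteratedDeriv i f z‖ ≤ K / s := by
  -- Below order `k` the next derivative is bounded, so the lift is continuous on the closed strip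
  -- and the maximum principle applies. Order `k` is treated as the derivative of order `k - 1`.
  rcases hi.lt_or_eq with hik | rfl
  · obtain ⟨M, hM⟩ := hf.exists_deriv_bound hik
    obtain ⟨hd, B, hB⟩ := hf i hi
    obtain ⟨h1, h2⟩ := ae_norm_iteratedDeriv_le hs0 hK hfK hi
    obtain ⟨w, rfl, -, -⟩ := exists_cover_eq (ne_zero_of_mem_annulus hs0 hz)
    have hw := (cover_mem_annulus_iff hs0 w).1 hz
    have h3 := norm_lift_le hs0 hs1 hd hB hM h1 h2 (strip_subset_closedStrip _ hw)
    rw [lift_eq hs0 hd hw] at h3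
    refine h3.trans ?_
    rw [le_div_iff₀ hs0]
    nlinarith
  · obtain ⟨i, rfl⟩ := Nat.exists_eq_succ_of_ne_zero hk.ne'
    obtain ⟨M, hM⟩ := hf.exists_deriv_bound (Nat.lt_succ_self i)
    obtain ⟨h1, h2⟩ := ae_norm_iteratedDeriv_le hs0 hK hfK le_rfl
    rw [Nat.succ_eq_add_one, iteratedDeriv_succ] at h1 h2 ⊢
    exact norm_deriv_le_of_bdryValue hs0 hs1 (hf i (Nat.le_succ i)).1 hM h1 h2 hz

end Sobolev

/-! ### Landau and Kolmogorov inequalities -/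

section Interpolation

/-- The maximum principle for midpoint convex finite sequences. -/
theorem le_max_of_midpoint_convex {k : ℕ} {t : ℕ → ℝ}
    (h : ∀ i, i + 1 < k → t (i + 1) ≤ (t i + t (i + 2)) / 2) {i : ℕ} (hi : i ≤ k) :
    t i ≤ max (t 0) (t k) := by
  classical
  obtain ⟨n, hn, hmax⟩ := Finset.exists_max_image (Finset.range (k + 1)) t ⟨0, by simp⟩
  -- Take the first maximiser: at an interior index its left neighbour would be strictly smaller,
  -- contradicting midpoint convexity.
  have hex : ∃ n, n ≤ k ∧ ∀ j ≤ k, t j ≤ t n :=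
    ⟨n, Nat.lt_succ_iff.1 (Finset.mem_range.1 hn), fun j hj =>
      hmax j (Finset.mem_range.2 (Nat.lt_succ_of_le hj))⟩
  obtain ⟨h1, h2⟩ := Nat.find_spec hex
  have hmin : ∀ {n}, n < Nat.find hex → _ := fun {n} hn => Nat.find_min hex hn
  set N := Nat.find hex
  refine (h2 i hi).trans ?_
  rcases h1.eq_or_lt with hN | hN
  · rw [hN]; exact le_max_right _ _
  rcases Nat.eq_zero_or_pos N with h0 | h0
  · rw [h0]; exact le_max_left _ _
  exfalso
  obtain ⟨p, hp⟩ := Nat.exists_eq_succ_of_ne_zero h0.ne'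
  have h3 := h p (by omega)
  have h4 := h2 (p + 2) (by omega)
  have h5 : t p < t N := by
    by_contra h6
    push Not at h6
    exact hmin (n := p) (by omega) ⟨by omega, fun j hj => (h2 j hj).trans h6⟩
  rw [hp, Nat.succ_eq_add_one] at h4 h5
  linarith

/-- Landau inequalities for consecutive terms of a sequence imply Kolmogorov inequalities. -/
theorem exists_interpolation_const (k : ℕ) {ℓ K : ℝ} (hℓ : 0 < ℓ) (hK : 0 < K) :
    ∃ A > 0, ∀ m : ℕ → ℝ, (∀ i ≤ k, m i ≤ K) →
      (∀ i, i + 1 < k → ∀ h, 0 < h → h ≤ ℓ → m (i + 1) ≤ 2 / h * m i + h * m (i + 2)) →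
      ∀ η > 0, m 0 ≤ η ^ k → ∀ i ≤ k, m i ≤ A * η ^ (k - i) := by
  set η₀ := min 1 (2 * ℓ / 8 ^ k) with hη₀
  have hη₀0 : 0 < η₀ := by positivity
  -- The weights satisfy `β i = 8^i β (i+1)`. With `h = 8^(i+1) η / 2`, Landau's inequality then
  -- becomes midpoint convexity of `m i / (β i η^(k-i))`. The cutoff `η₀` guarantees `h ≤ ℓ`; larger
  -- `η` are covered by the a priori bound `K`.
  set β : ℕ → ℝ := fun i => (1 / 8) ^ (i.choose 2) with hβ
  have hβ0 : ∀ i, 0 < β i := fun i => by positivity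
  have hβ1 : ∀ i, β i ≤ 1 := fun i => pow_le_one₀ (by norm_num) (by norm_num)
  have hβs : ∀ i, β i = 8 ^ i * β (i + 1) := by
    intro i
    simp only [hβ]
    rw [Nat.choose_succ_succ' i 1, Nat.choose_one_right, pow_add, ← mul_assoc, ← mul_pow]
    norm_num
  refine ⟨max (K / η₀ ^ k) (max 1 (K / β k)), by positivity, ?_⟩
  intro m hm hL η hη h0 i hi
  rcases le_or_gt η₀ η with h | h
  · have hη₀1 : η₀ ≤ 1 := min_le_left _ _
    calc m i ≤ K := hm i hi
      _ = K / η₀ ^ k * η₀ ^ k := by field_simp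
      _ ≤ K / η₀ ^ k * η₀ ^ (k - i) := by
          gcongr ?_ * ?_
          exact pow_le_pow_of_le_one hη₀0.le hη₀1 (Nat.sub_le k i)
      _ ≤ K / η₀ ^ k * η ^ (k - i) := by gcongr
      _ ≤ _ := by gcongr; exact le_max_left _ _
  · set t : ℕ → ℝ := fun i => m i / (β i * η ^ (k - i)) with ht
    have hmt : ∀ i, m i = t i * (β i * η ^ (k - i)) := by
      intro i
      have := hβ0 i
      rw [ht]; field_simp
    have hconv : ∀ i, i + 1 < k → t (i + 1) ≤ (t i + t (i + 2)) / 2 := by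
      intro i hik
      have h8 : (8 : ℝ) ^ (i + 1) * η / 2 ≤ ℓ := by
        have h1 : (8 : ℝ) ^ (i + 1) ≤ 8 ^ k := pow_le_pow_right₀ (by norm_num) hik.le
        have h2 : η * 8 ^ k < 2 * ℓ := (lt_div_iff₀ (by positivity)).1 (h.trans_le (min_le_right _ _))
        nlinarith
      have h3 := hL i hik (8 ^ (i + 1) * η / 2) (by positivity) h8
      obtain ⟨d, rfl⟩ := Nat.exists_eq_add_of_lt hik
      have hd1 : i + 1 + d + 1 - (i + 1) = d + 1 := by omega
      have hd2 : i + 1 + d + 1 - i = d + 2 := by omega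
      have hd3 : i + 1 + d + 1 - (i + 2) = d := by omega
      have hmt1 := hmt (i + 1)
      have hmt2 := hmt i
      have hmt3 := hmt (i + 2)
      rw [hd1] at hmt1
      rw [hd2, hβs i] at hmt2
      rw [hd3] at hmt3
      have hb := hβs (i + 1)
      have hp : 0 < β (i + 1) * η ^ (d + 1) := mul_pos (hβ0 _) (by positivity)
      have e : 2 / (8 ^ (i + 1) * η / 2) * m i + 8 ^ (i + 1) * η / 2 * m (i + 2) =
          (t i + t (i + 2)) / 2 * (β (i + 1) * η ^ (d + 1)) := by
        rw [hmt2, hmt3, hb]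
        field_simp
        ring
      rw [e, hmt1] at h3
      exact le_of_mul_le_mul_right h3 hp
    have h1 := le_max_of_midpoint_convex hconv hi
    have h2 : t 0 ≤ 1 := by
      rw [ht]; simp only [hβ]
      rw [div_le_one (by positivity)]
      simpa using h0
    have h3 : t k ≤ K / β k := by
      rw [ht]; simp only [Nat.sub_self, pow_zero, mul_one]
      have := hβ0 k
      gcongr
      exact hm k le_rfl
    have h4 : t i ≤ max 1 (K / β k) := h1.trans (max_le_max h2 h3)
    calc m i = t i * (β i * η ^ (k - i)) := hmt i
      _ ≤ max 1 (K / β k) * (1 * η ^ (k - i)) := by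
          have := hβ0 i
          gcongr
          exact hβ1 i
      _ ≤ _ := by
          rw [one_mul]
          exact mul_le_mul_of_nonneg_right (le_max_right _ _) (by positivity)

/-- From each point of the annulus starts a radial segment of length `(1 - s) / 4`. -/
theorem exists_radial_segment {s : ℝ} (hs0 : 0 < s) {z : ℂ} (hz : z ∈ annulus s) :
    ∃ u : ℂ, ‖u‖ = 1 ∧ ∀ t : ℝ, 0 ≤ t → t ≤ (1 - s) / 4 → z + t * u ∈ annulus s ∧
      min (1 - s) t / 4 ≤ min (1 - ‖z + t * u‖) (‖z + t * u‖ - s) := by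
  have hz0 : 0 < ‖z‖ := hs0.trans hz.1
  have hz0' : (‖z‖ : ℂ) ≠ 0 := by exact_mod_cast hz0.ne'
  have hn : ∀ ε : ℝ, |ε| = 1 → ‖(ε * (z / ‖z‖) : ℂ)‖ = 1 := by
    intro ε hε
    rw [norm_mul, norm_div, Complex.norm_real, Complex.norm_real, norm_norm, div_self hz0.ne',
      Real.norm_eq_abs, hε, mul_one]
  have hn2 : ∀ ε t : ℝ, 0 ≤ ‖z‖ + t * ε → ‖z + t * (ε * (z / ‖z‖))‖ = ‖z‖ + t * ε := by
    intro ε t h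
    have e : z + t * (ε * (z / ‖z‖)) = ((‖z‖ + t * ε : ℝ) : ℂ) * (z / ‖z‖) := by
      push_cast; field_simp
    rw [e, norm_mul, norm_div, Complex.norm_real, Complex.norm_real, norm_norm, div_self hz0.ne',
      mul_one, Real.norm_of_nonneg h]
  -- The segment heads for the middle circle: after length `t` it is at least `t` from the near
  -- circle and `(1 - s) / 4` from the far one.
  rcases le_total ‖z‖ ((1 + s) / 2) with h | h
  · refine ⟨(1 : ℝ) * (z / ‖z‖), hn 1 (by simp), fun t ht0 ht1 => ?_⟩
    have h1 := hz.1
    rw [annulus, Set.mem_ofPred_eq, hn2 1 t (by linarith)]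
    have : min (1 - s) t ≤ t := min_le_right _ _
    refine ⟨⟨by linarith, by linarith⟩, le_min (by linarith) (by linarith)⟩
  · refine ⟨(-1 : ℝ) * (z / ‖z‖), hn (-1) (by simp), fun t ht0 ht1 => ?_⟩
    have h1 := hz.2
    rw [annulus, Set.mem_ofPred_eq, hn2 (-1) t (by linarith)]
    have : min (1 - s) t ≤ t := min_le_right _ _
    refine ⟨⟨by linarith, by linarith⟩, le_min (by linarith) (by linarith)⟩

theorem norm_add_mul_sub_le {s : ℝ} {g g' : ℂ → ℂ} {z u : ℂ} {h B : ℝ} (hh : 0 ≤ h)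
    (hu : ‖u‖ = 1) (hseg : ∀ t : ℝ, 0 ≤ t → t ≤ h → z + t * u ∈ annulus s)
    (hg : ∀ z ∈ annulus s, HasDerivAt g (g' z) z)
    (hB : ∀ t : ℝ, 0 ≤ t → t ≤ h → ‖g' (z + t * u)‖ ≤ B) :
    ‖g (z + h * u) - g z‖ ≤ B * h := by
  have hx : ∀ x ∈ segment ℝ z (z + h * u), ∃ t : ℝ, 0 ≤ t ∧ t ≤ h ∧ x = z + t * u := by
    intro x hx
    rw [segment_eq_image'] at hx
    obtain ⟨t, ht, rfl⟩ := hx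
    refine ⟨t * h, mul_nonneg ht.1 hh, mul_le_of_le_one_left hh ht.2, ?_⟩
    simp [mul_assoc]
  have := Convex.norm_image_sub_le_of_norm_hasDerivWithin_le (𝕜 := ℂ) (f := g) (f' := g') (C := B)
    (s := segment ℝ z (z + h * u)) (x := z) (y := z + h * u)
    (fun x hxs => by
      obtain ⟨t, h1, h2, rfl⟩ := hx x hxs
      exact (hg _ (hseg t h1 h2)).hasDerivWithinAt)
    (fun x hxs => by
      obtain ⟨t, h1, h2, rfl⟩ := hx x hxs
      exact hB t h1 h2)
    (convex_segment _ _) (left_mem_segment _ _ _) (right_mem_segment _ _ _)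
  rwa [add_sub_cancel_left, norm_mul, hu, mul_one, Complex.norm_real, Real.norm_of_nonneg hh] at this

/-- Landau's inequality on the annulus. -/
theorem landau_inequality {s : ℝ} (hs0 : 0 < s) {g g' g'' : ℂ → ℂ}
    (hg : ∀ z ∈ annulus s, HasDerivAt g (g' z) z)
    (hg' : ∀ z ∈ annulus s, HasDerivAt g' (g'' z) z) {m m'' : ℝ}
    (hm : ∀ z ∈ annulus s, ‖g z‖ ≤ m) (hm'' : ∀ z ∈ annulus s, ‖g'' z‖ ≤ m'')
    {h : ℝ} (hh : 0 < h) (hhs : h ≤ (1 - s) / 4) {z : ℂ} (hz : z ∈ annulus s) :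
    ‖g' z‖ ≤ 2 / h * m + h * m'' := by
  obtain ⟨u, hu, hseg⟩ := exists_radial_segment hs0 hz
  have hmem : ∀ t : ℝ, 0 ≤ t → t ≤ h → z + t * u ∈ annulus s := fun t h0 h1 =>
    (hseg t h0 (h1.trans hhs)).1
  have hm0 : 0 ≤ m'' := (norm_nonneg _).trans (hm'' z hz)
  have h1 : ∀ t : ℝ, 0 ≤ t → t ≤ h → ‖g' (z + t * u) - g' z‖ ≤ m'' * h := by
    intro t h0 h1
    refine (norm_add_mul_sub_le h0 hu (fun r hr0 hr1 => hmem r hr0 (hr1.trans h1)) hg'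
      (fun r hr0 hr1 => hm'' _ (hmem r hr0 (hr1.trans h1)))).trans ?_
    gcongr
  -- Removing the linear part leaves a function with derivative at most `m'' h` on the segment: a
  -- first-order Taylor estimate.
  have h2 := norm_add_mul_sub_le (g := fun w => g w - w * g' z) (g' := fun w => g' w - g' z)
    hh.le hu hmem (fun w hw => by
      have h3 := (hg w hw).sub ((hasDerivAt_id w).mul_const (g' z))
      rwa [one_mul] at h3) h1
  have e : (g (z + h * u) - (z + h * u) * g' z) - (g z - z * g' z) =
      (g (z + h * u) - g z) - h * u * g' z := by ring
  rw [e] at h2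
  have h3 : ‖(h * u * g' z : ℂ)‖ = h * ‖g' z‖ := by
    rw [norm_mul, norm_mul, hu, Complex.norm_real, Real.norm_of_nonneg hh.le, mul_one]
  have h4 : h * ‖g' z‖ ≤ 2 * m + m'' * h * h := by
    rw [← h3]
    calc ‖(h * u * g' z : ℂ)‖ = ‖(g (z + h * u) - g z) - ((g (z + h * u) - g z) - h * u * g' z)‖ := by
          congr 1; ring
      _ ≤ (‖g (z + h * u)‖ + ‖g z‖) + m'' * h * h := by
          refine (norm_sub_le _ _).trans (add_le_add (norm_sub_le _ _) h2)
      _ ≤ 2 * m + m'' * h * h := by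
          have := hm _ (hmem h hh.le le_rfl)
          have := hm z hz
          linarith
  have h5 : ‖g' z‖ ≤ (2 * m + m'' * h * h) / h := by
    rw [le_div_iff₀ hh]; linarith
  refine h5.trans (le_of_eq ?_)
  field_simp

/-- Kolmogorov inequalities for derivatives on the annulus. -/
theorem exists_norm_le_interpolation {s : ℝ} (hs0 : 0 < s) (hs1 : s < 1) (k : ℕ) {K : ℝ}
    (hK : 0 < K) :
    ∃ A > 0, ∀ F : ℕ → ℂ → ℂ, (∀ i < k, ∀ z ∈ annulus s, HasDerivAt (F i) (F (i + 1) z) z) →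
      (∀ i ≤ k, ∀ z ∈ annulus s, ‖F i z‖ ≤ K) →
      ∀ η > 0, (∀ z ∈ annulus s, ‖F 0 z‖ ≤ η ^ k) →
      ∀ i ≤ k, ∀ z ∈ annulus s, ‖F i z‖ ≤ A * η ^ (k - i) := by
  obtain ⟨A, hA, h⟩ := exists_interpolation_const k (ℓ := (1 - s) / 4) (by linarith) hK
  refine ⟨A, hA, fun F hF hFK η hη h0 i hi z hz => ?_⟩
  have hne : Nonempty (annulus s) := ⟨⟨z, hz⟩⟩
  set m : ℕ → ℝ := fun i => ⨆ z : annulus s, ‖F i z‖ with hm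
  have hle : ∀ i ≤ k, ∀ z ∈ annulus s, ‖F i z‖ ≤ m i := fun i hi z hz =>
    le_ciSup (f := fun z : annulus s => ‖F i z‖)
      ⟨K, by rintro _ ⟨w, rfl⟩; exact hFK i hi w w.2⟩ ⟨z, hz⟩
  refine (hle i hi z hz).trans (h m (fun i hi => ciSup_le fun w => hFK i hi w w.2) ?_ η hη
    (ciSup_le fun w => h0 w w.2) i hi)
  intro i hik t ht hts
  exact ciSup_le fun w => landau_inequality hs0 (hF i (by omega)) (hF (i + 1) hik)
    (hle i (by omega)) (hle (i + 2) (by omega)) ht hts w.2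

end Interpolation

/-! ### Arcs in the boundary and mean values -/

instance (r : ℝ) : IsFiniteMeasure (circleMeasure r) := by
  have : IsFiniteMeasure (ENNReal.ofReal (1 / (2 * Real.pi)) •
      (volume : Measure ℝ).restrict (Set.Ioc 0 (2 * Real.pi))) :=
    Measure.smul_finite _ ENNReal.ofReal_ne_top
  unfold circleMeasure; infer_instance

instance (s : ℝ) : IsFiniteMeasure (bdryMeasure s) := by
  unfold bdryMeasure; infer_instance

/-- The free starting angle allows cutting the period at a point outside `I`, or at the start of a
given arc. -/
theorem integral_circleMeasure (r : ℝ) {G : ℂ → ℝ} (hG : Measurable G) (a : ℝ) :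
    ∫ ζ, G ζ ∂(circleMeasure r) =
      (2 * Real.pi)⁻¹ * ∫ θ in a..a + 2 * Real.pi, G (circleMap 0 r θ) := by
  have hpi := Real.two_pi_pos
  have hper : Function.Periodic (fun θ => G (circleMap 0 r θ)) (2 * Real.pi) := fun θ => by
    simp only [periodic_circleMap 0 r θ]
  rw [circleMeasure, integral_map (measurable_circleMap 0 r).aemeasurable
    hG.aestronglyMeasurable, integral_smul_measure, ENNReal.toReal_ofReal (by positivity),
    hper.intervalIntegral_add_eq a 0, zero_add, intervalIntegral.integral_of_le hpi.le,
    smul_eq_mul, one_div]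

/-- A connected subset of the boundary lies on one of the two circles. -/
theorem exists_subset_sphere {s : ℝ} (hs1 : s < 1) {I : Set ℂ} (hI : IsConnected I)
    (hIb : I ⊆ bdry s) : ∃ r, (r = s ∨ r = 1) ∧ I ⊆ Metric.sphere 0 r := by
  obtain ⟨z, hz⟩ := hI.nonempty
  have hn : ∀ w ∈ I, ‖w‖ = s ∨ ‖w‖ = 1 := fun w hw => by
    simpa [bdry] using hIb hw
  have hoc := (hI.isPreconnected.image _ continuous_norm.continuousOn).ordConnected
  have hmid : ∀ x ∈ I, ∀ y ∈ I, ‖x‖ = s → ‖y‖ = 1 → False := by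
    intro x hx y hy hxs hy1
    obtain ⟨w, hw, hws⟩ := hoc.out ⟨x, hx, rfl⟩ ⟨y, hy, rfl⟩
      (show (s + 1) / 2 ∈ Set.Icc ‖x‖ ‖y‖ by rw [hxs, hy1]; constructor <;> linarith)
    rcases hn w hw with h | h <;> linarith
  rcases hn z hz with h | h
  · refine ⟨s, Or.inl rfl, fun w hw => ?_⟩
    rcases hn w hw with h' | h'
    · simpa using h'
    · exact (hmid z hz w hw h h').elim
  · refine ⟨1, Or.inr rfl, fun w hw => ?_⟩
    rcases hn w hw with h' | h'
    · exact (hmid w hw z hz h' h).elim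
    · simpa using h'

/-- The left side is an affine function vanishing on the chord through the points of angles `a` and
`b`; the factorisation shows its sign on each arc and that it has no other zeros on the circle. -/
theorem re_circleMap_sub_cos {r : ℝ} (hr : r ≠ 0) (a b x : ℝ) :
    (Complex.exp (-((a + b) / 2 : ℝ) * Complex.I) * circleMap 0 r x).re / r - Real.cos ((b - a) / 2) =
      -2 * Real.sin ((x - a) / 2) * Real.sin ((x - b) / 2) := by
  have e : Complex.exp (-((a + b) / 2 : ℝ) * Complex.I) * circleMap 0 r x =
      circleMap 0 r (x - (a + b) / 2) := by
    rw [circleMap_zero, circleMap_zero, mul_left_comm, ← Complex.exp_add]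
    congr 2
    push_cast; ring
  rw [e, circleMap_zero, Complex.re_ofReal_mul, Complex.exp_ofReal_mul_I_re,
    mul_div_cancel_left₀ _ hr, Real.cos_sub_cos]
  congr 3 <;> ring

/-- The angles of the points of a connected subset of a circle that misses the point of angle `a`
form an interval. -/
theorem ordConnected_angles {r : ℝ} (hr : 0 < r) {I : Set ℂ} (hI : IsPreconnected I)
    (hIs : I ⊆ Metric.sphere 0 r) {a : ℝ} (ha : circleMap 0 r a ∉ I) :
    (Set.Ioc a (a + 2 * Real.pi) ∩ circleMap 0 r ⁻¹' I).OrdConnected := by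
  have hmem : ∀ {x}, x ∈ Set.Ioc a (a + 2 * Real.pi) ∩ circleMap 0 r ⁻¹' I →
      x < a + 2 * Real.pi := by
    intro x hx
    refine lt_of_le_of_ne hx.1.2 fun h => ha ?_
    have := hx.2
    rwa [h, Set.mem_preimage, periodic_circleMap 0 r a] at this
  refine ⟨fun x hx y hy w hw => ?_⟩
  refine ⟨⟨hx.1.1.trans_le hw.1, hw.2.trans hy.1.2⟩, ?_⟩
  by_contra hwI
  have hxw : x < w := lt_of_le_of_ne hw.1 fun h => hwI (h ▸ hx.2)
  have hwy : w < y := lt_of_le_of_ne hw.2 fun h => hwI (h ▸ hy.2)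
  -- The chord through the points of angles `a` and `w` separates those of angles `x` and `y`.
  -- Connectedness would force a point of `I` onto the chord, but neither of its ends is in `I`.
  set h : ℂ → ℝ := fun z =>
    (Complex.exp (-((a + w) / 2 : ℝ) * Complex.I) * z).re / r - Real.cos ((w - a) / 2) with hh
  have hc : Continuous h := by simp only [hh]; fun_prop
  have hval : ∀ θ, h (circleMap 0 r θ) = -2 * Real.sin ((θ - a) / 2) * Real.sin ((θ - w) / 2) :=
    re_circleMap_sub_cos hr.ne' a w
  have hy2 := hmem hy
  have hax := hx.1.1
  have hpi := Real.pi_pos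
  have hxpos : 0 ≤ h (circleMap 0 r x) := by
    rw [hval]
    have h1 : 0 < Real.sin ((x - a) / 2) := Real.sin_pos_of_pos_of_lt_pi (by linarith) (by linarith)
    have h2 : 0 < Real.sin ((w - x) / 2) := Real.sin_pos_of_pos_of_lt_pi (by linarith) (by linarith)
    have h3 : Real.sin ((x - w) / 2) = -Real.sin ((w - x) / 2) := by
      rw [← Real.sin_neg]; congr 1; ring
    rw [h3]; nlinarith [mul_pos h1 h2]
  have hyneg : h (circleMap 0 r y) ≤ 0 := by
    rw [hval]
    have h1 : 0 < Real.sin ((y - a) / 2) := Real.sin_pos_of_pos_of_lt_pi (by linarith) (by linarith)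
    have h2 : 0 < Real.sin ((y - w) / 2) := Real.sin_pos_of_pos_of_lt_pi (by linarith) (by linarith)
    nlinarith [mul_pos h1 h2]
  obtain ⟨z, hz, hz0⟩ := hI.intermediate_value hy.2 hx.2 hc.continuousOn ⟨hyneg, hxpos⟩
  have hz' : z ∈ Set.range (circleMap 0 r) := by
    rw [range_circleMap, abs_of_pos hr]; exact hIs hz
  obtain ⟨θ, rfl⟩ := hz'
  have hper : ∀ b : ℝ, Real.sin ((θ - b) / 2) = 0 → circleMap 0 r θ = circleMap 0 r b := by
    intro b hb
    obtain ⟨n, hn⟩ := Real.sin_eq_zero_iff.1 hb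
    have : θ = b + n * (2 * Real.pi) := by linarith
    rw [this, (periodic_circleMap 0 r).int_mul n b]
  rw [hval] at hz0
  rcases mul_eq_zero.1 hz0 with h1 | h1
  · exact ha (hper a (by linarith) ▸ hz)
  · rw [hper w h1] at hz
    exact hwI hz

/-- A connected relatively open subset of the boundary of measure `lam` contains an arc of angular
length `π lam`. -/
theorem exists_arc_subset {s : ℝ} (hs0 : 0 < s) (hs1 : s < 1) {lam : ℝ} (hlam : 0 < lam)
    {I : Set ℂ} (hI : IsConnected I) (hIb : I ⊆ bdry s) (hIm : MeasurableSet I)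
    (hμ : bdryMeasure s I = ENNReal.ofReal lam) :
    ∃ r, (r = s ∨ r = 1) ∧ I ⊆ Metric.sphere 0 r ∧
      ∃ α : ℝ, ∀ θ ∈ Set.Icc α (α + Real.pi * lam), circleMap 0 r θ ∈ I := by
  obtain ⟨r, hr, hIr⟩ := exists_subset_sphere hs1 hI hIb
  have hr0 : 0 < r := by rcases hr with rfl | rfl <;> linarith
  refine ⟨r, hr, hIr, ?_⟩
  by_cases hfull : ∀ θ, circleMap 0 r θ ∈ I
  · exact ⟨0, fun θ _ => hfull θ⟩
  push Not at hfull
  obtain ⟨a, ha⟩ := hfull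
  have hzero : ∀ r' : ℝ, 0 < r' → r' ≠ r → circleMeasure r' I = 0 := by
    intro r' hr'0 hr'
    have : circleMap 0 r' ⁻¹' I = ∅ := by
      ext θ
      simp only [Set.mem_preimage, Set.mem_empty_iff_false, iff_false]
      intro h
      have := hIr h
      rw [mem_sphere_zero_iff_norm, norm_circleMap_zero, abs_of_pos hr'0] at this
      exact hr' this
    rw [circleMeasure, Measure.map_apply (measurable_circleMap 0 r') hIm, this, measure_empty]
  have hcm : (circleMeasure r).real I = lam := by
    have h1 : bdryMeasure s I = circleMeasure r I := by
      rw [bdryMeasure, Measure.add_apply]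
      rcases hr with rfl | rfl
      · rw [hzero 1 one_pos hs1.ne', add_zero]
      · rw [hzero s hs0 hs1.ne, zero_add]
    rw [Measure.real, ← h1, hμ, ENNReal.toReal_ofReal hlam.le]
  have hpi := Real.pi_pos
  set J := Set.Ioc a (a + 2 * Real.pi) ∩ circleMap 0 r ⁻¹' I with hJ
  have hJm : MeasurableSet (circleMap 0 r ⁻¹' I) := measurable_circleMap 0 r hIm
  have hJv : volume.real J = 2 * Real.pi * lam := by
    have h1 := integral_circleMeasure r (G := I.indicator 1) (measurable_one.indicator hIm) a
    have h2 : (fun θ => I.indicator (1 : ℂ → ℝ) (circleMap 0 r θ)) =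
        (circleMap 0 r ⁻¹' I).indicator 1 := by
      ext θ; rfl
    rw [integral_indicator_one hIm, hcm, h2, intervalIntegral.integral_of_le (by linarith),
      integral_indicator_one hJm, measureReal_restrict_apply hJm, Set.inter_comm] at h1
    rw [h1, hJ]; field_simp
  -- `J` has length `2π lam`; asking for half of it avoids any discussion of endpoints.
  obtain ⟨x, hx, y, hy, hxy⟩ : ∃ x ∈ J, ∃ y ∈ J, Real.pi * lam < y - x := by
    by_contra hcon
    push Not at hcon
    have h1 : volume J ≤ ENNReal.ofReal (Real.pi * lam) := by
      refine (Real.volume_le_diam J).trans (Metric.ediam_le fun x hx y hy => ?_)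
      rw [edist_dist, Real.dist_eq]
      exact ENNReal.ofReal_le_ofReal (abs_le.2 ⟨by linarith [hcon x hx y hy],
        by linarith [hcon y hy x hx]⟩)
    have h2 := ENNReal.toReal_mono ENNReal.ofReal_ne_top h1
    rw [ENNReal.toReal_ofReal (by positivity)] at h2
    have h3 : (volume J).toReal = 2 * Real.pi * lam := hJv
    nlinarith [mul_pos hpi hlam]
  refine ⟨x, fun θ hθ => ?_⟩
  exact ((ordConnected_angles hr0 hI.isPreconnected hIr ha).out hx hy
    ⟨hθ.1, by linarith [hθ.2]⟩).2

/-- A nonnegative bounded Lipschitz function with small integral is small. -/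
theorem sq_le_integral {φ : ℝ → ℝ} {M B ℓ : ℝ} (hM : 0 < M) (hB : 0 < B) (hℓ : 0 < ℓ)
    (h0 : ∀ x, 0 ≤ φ x) (hφB : ∀ x, φ x ≤ B) (hL : ∀ x y, |φ x - φ y| ≤ M * |x - y|) {α θ : ℝ}
    (hθ : θ ∈ Set.Icc α (α + ℓ)) :
    φ θ ^ 2 ≤ 2 / min (1 / (2 * M)) (ℓ / (2 * B)) * ∫ x in α..α + ℓ, φ x := by
  have hcont : Continuous φ := by
    have : LipschitzWith M.toNNReal φ := LipschitzWith.of_dist_le_mul fun x y => by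
      rw [Real.coe_toNNReal _ hM.le, Real.dist_eq, Real.dist_eq]; exact hL x y
    exact this.continuous
  -- On an interval of length `d = c φ(θ)` containing `θ` the function stays above `φ(θ) / 2` (first
  -- entry), and that interval fits inside the arc because `d ≤ ℓ / 2` (second entry).
  set c := min (1 / (2 * M)) (ℓ / (2 * B)) with hc
  have hc0 : 0 < c := by positivity
  set d := c * φ θ with hd
  have hd0 : 0 ≤ d := mul_nonneg hc0.le (h0 θ)
  have hd1 : d ≤ ℓ / 2 := by
    calc d ≤ ℓ / (2 * B) * B := mul_le_mul (min_le_right _ _) (hφB θ) (h0 θ) (by positivity)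
      _ = ℓ / 2 := by field_simp
  have hd2 : M * d ≤ φ θ / 2 := by
    calc M * d ≤ M * (1 / (2 * M) * φ θ) := by
          gcongr
          exact mul_le_mul_of_nonneg_right (min_le_left _ _) (h0 θ)
      _ = φ θ / 2 := by field_simp
  obtain ⟨u, hu1, hu2, hu3, hu4⟩ : ∃ u, α ≤ u ∧ u + d ≤ α + ℓ ∧ u ≤ θ ∧ θ ≤ u + d := by
    rcases le_total θ (α + ℓ / 2) with h | h
    · exact ⟨θ, hθ.1, by linarith, le_rfl, by linarith⟩
    · exact ⟨θ - d, by linarith, by linarith [hθ.2], by linarith, by linarith⟩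
  have hlow : ∀ x ∈ Set.Icc u (u + d), φ θ / 2 ≤ φ x := by
    intro x hx
    have h1 := hL θ x
    have h2 : |θ - x| ≤ d := abs_le.2 ⟨by linarith [hx.2], by linarith [hx.1]⟩
    have h3 : φ θ - φ x ≤ M * d := (le_abs_self _).trans (h1.trans (by gcongr))
    linarith
  have hint1 : d * (φ θ / 2) ≤ ∫ x in u..u + d, φ x := by
    have := intervalIntegral.integral_mono_on (μ := volume) (a := u) (b := u + d)
      (f := fun _ => φ θ / 2) (g := φ)
      (by linarith) (by simp) (hcont.intervalIntegrable _ _) hlow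
    rwa [intervalIntegral.integral_const, smul_eq_mul, add_sub_cancel_left] at this
  have hint2 : ∫ x in u..u + d, φ x ≤ ∫ x in α..α + ℓ, φ x :=
    intervalIntegral.integral_mono_interval hu1 (by linarith) hu2
      (Eventually.of_forall h0) (hcont.intervalIntegrable _ _)
  have h4 : c * φ θ ^ 2 ≤ 2 * ∫ x in α..α + ℓ, φ x := by
    have : c * φ θ ^ 2 = 2 * (d * (φ θ / 2)) := by rw [hd]; ring
    rw [this]; linarith
  rw [div_mul_eq_mul_div, le_div_iff₀ hc0]
  linarith

theorem l1Norm_nonneg (s : ℝ) (I : Set ℂ) (f : ℂ → ℂ) : 0 ≤ l1Norm s I f :=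
  mul_nonneg (inv_nonneg.2 ENNReal.toReal_nonneg) (integral_nonneg fun _ => norm_nonneg _)

/-- The integral over an arc contained in `I` is controlled by the `L¹(I)` norm. -/
theorem integral_arc_le {s r lam : ℝ} (hr : r = s ∨ r = 1)
    (hlam : 0 < lam) (hlam1 : lam ≤ 1) {I : Set ℂ} (hIm : MeasurableSet I)
    (hIr : I ⊆ Metric.sphere 0 r)
    (hμ : bdryMeasure s I = ENNReal.ofReal lam) {f : ℂ → ℂ} {B : ℝ}
    (hc : Continuous fun θ => bdryValue s f (circleMap 0 r θ))
    (hB : ∀ θ, ‖bdryValue s f (circleMap 0 r θ)‖ ≤ B) {α : ℝ}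
    (hα : ∀ θ ∈ Set.Icc α (α + Real.pi * lam), circleMap 0 r θ ∈ I) :
    ∫ θ in α..α + Real.pi * lam, ‖bdryValue s f (circleMap 0 r θ)‖ ≤
      2 * Real.pi * lam * l1Norm s I f := by
  have hpi := Real.pi_pos
  -- Passing through the argument gives a globally measurable function that agrees with the boundary
  -- values on `I`.
  set G : ℂ → ℝ := I.indicator fun ζ => ‖bdryValue s f (circleMap 0 r ζ.arg)‖ with hG
  have hGm : Measurable G :=
    (hc.norm.measurable.comp Complex.measurable_arg).indicator hIm
  have harg : ∀ ζ ∈ I, circleMap 0 r ζ.arg = ζ := by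
    intro ζ hζ
    have : ‖ζ‖ = r := by simpa using hIr hζ
    rw [circleMap_zero, ← this, Complex.norm_mul_exp_arg_mul_I]
  have hG0 : ∀ ζ, 0 ≤ G ζ := fun ζ => Set.indicator_nonneg (fun _ _ => norm_nonneg _) ζ
  have hB0 : 0 ≤ B := (norm_nonneg _).trans (hB 0)
  have hGB : ∀ ζ, ‖G ζ‖ ≤ B := by
    intro ζ
    rw [Real.norm_of_nonneg (hG0 ζ), hG]
    exact Set.indicator_le' (fun _ _ => hB _) (fun _ _ => hB0) ζ
  have hGi : Integrable G (bdryMeasure s) :=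
    Integrable.of_bound hGm.aestronglyMeasurable B (Eventually.of_forall hGB)
  have h1 : ∫ ζ in I, ‖bdryValue s f ζ‖ ∂(bdryMeasure s) = ∫ ζ, G ζ ∂(bdryMeasure s) := by
    rw [hG, integral_indicator hIm]
    refine setIntegral_congr_fun hIm fun ζ hζ => ?_
    simp only [harg ζ hζ]
  have h2 : lam * l1Norm s I f = ∫ ζ, G ζ ∂(bdryMeasure s) := by
    rw [l1Norm, hμ, ENNReal.toReal_ofReal hlam.le, h1, mul_inv_cancel_left₀ hlam.ne']
  have h3 : ∫ ζ, G ζ ∂(circleMeasure r) ≤ ∫ ζ, G ζ ∂(bdryMeasure s) :=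
    integral_mono_measure (circleMeasure_le_bdryMeasure hr) (Eventually.of_forall hG0) hGi
  rw [integral_circleMeasure r hGm α] at h3
  have hle : Real.pi * lam ≤ 2 * Real.pi := by nlinarith
  have hGint : ∀ a b : ℝ, IntervalIntegrable (fun θ => G (circleMap 0 r θ)) volume a b := by
    intro a b
    refine (intervalIntegrable_const (c := B)).mono_fun
      (hGm.comp (measurable_circleMap 0 r)).aestronglyMeasurable (Eventually.of_forall fun θ => ?_)
    exact (hGB _).trans (le_abs_self B)
  have h4 : ∫ θ in α..α + Real.pi * lam, ‖bdryValue s f (circleMap 0 r θ)‖ ≤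
      ∫ θ in α..α + 2 * Real.pi, G (circleMap 0 r θ) := by
    have h5 : ∫ θ in α..α + Real.pi * lam, ‖bdryValue s f (circleMap 0 r θ)‖ =
        ∫ θ in α..α + Real.pi * lam, G (circleMap 0 r θ) := by
      refine intervalIntegral.integral_congr fun θ hθ => ?_
      rw [Set.uIcc_of_le (by nlinarith)] at hθ
      have := hα θ hθ
      simp only [hG, Set.indicator_of_mem this, harg _ this]
    rw [h5]
    exact intervalIntegral.integral_mono_interval le_rfl (by nlinarith) (by linarith)
      (Eventually.of_forall fun θ => hG0 _) (hGint _ _)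
  rw [← h2, inv_mul_le_iff₀ (by positivity)] at h3
  linarith

/-! ### Two constants theorem on the annulus -/

theorem norm_lift_le_of_norm_le {s : ℝ} (hs0 : 0 < s) (hs1 : s < 1) {f : ℂ → ℂ} {M m : ℝ}
    (hf : DifferentiableOn ℂ f (annulus s)) (hM : ∀ z ∈ annulus s, ‖deriv f z‖ ≤ M)
    (hm : ∀ z ∈ annulus s, ‖f z‖ ≤ m) {w : ℂ} (hw : w ∈ closedStrip (q0 s)) :
    ‖lift s f w‖ ≤ m := by
  have h := (tendsto_comp_cover hs0 hs1 hf hM hw).norm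
  rw [← closure_strip (q0_pos hs0 hs1), mem_closure_iff_nhdsWithin_neBot] at hw
  refine le_of_tendsto h ?_
  filter_upwards [self_mem_nhdsWithin] with v hv
  exact hm _ ((cover_mem_annulus_iff hs0 v).2 hv)

/-- The boundary function of a function with bounded derivative is bounded and Lipschitz on each
of the two circles. -/
theorem bdryValue_circle {s : ℝ} (hs0 : 0 < s) (hs1 : s < 1) {f : ℂ → ℂ} {M m : ℝ}
    (hf : DifferentiableOn ℂ f (annulus s)) (hM : ∀ z ∈ annulus s, ‖deriv f z‖ ≤ M) (hM0 : 0 ≤ M)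
    (hm : ∀ z ∈ annulus s, ‖f z‖ ≤ m) {r : ℝ} (hr : r = s ∨ r = 1) :
    (∀ θ, ‖bdryValue s f (circleMap 0 r θ)‖ ≤ m) ∧
      ∀ x y, ‖bdryValue s f (circleMap 0 r x) - bdryValue s f (circleMap 0 r y)‖ ≤ M * |x - y| := by
  have hq := (q0_pos hs0 hs1).le
  rcases hr with rfl | rfl
  · simp only [bdryValue_inner hs0 hs1 hf hM]
    refine ⟨fun θ => norm_lift_le_of_norm_le hs0 hs1 hf hM hm (ofReal_add_mem_closedStrip hq θ),
      fun x y => ?_⟩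
    refine (norm_lift_sub_le hs0 hs1 hf hM hM0 (ofReal_add_mem_closedStrip hq x)
      (ofReal_add_mem_closedStrip hq y)).trans (le_of_eq ?_)
    rw [add_sub_add_right_eq_sub, ← Complex.ofReal_sub, Complex.norm_real, Real.norm_eq_abs]
  · simp only [bdryValue_outer hs0 hs1 hf hM]
    refine ⟨fun θ => norm_lift_le_of_norm_le hs0 hs1 hf hM hm (ofReal_mem_closedStrip hq θ),
      fun x y => ?_⟩
    refine (norm_lift_sub_le hs0 hs1 hf hM hM0 (ofReal_mem_closedStrip hq x)
      (ofReal_mem_closedStrip hq y)).trans (le_of_eq ?_)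
    rw [← Complex.ofReal_sub, Complex.norm_real, Real.norm_eq_abs]

/-- Choosing the preimage in the period centred at the midpoint of the arc makes the strip estimate
uniform in the position of the arc. -/
theorem exists_cover_eq_near {z : ℂ} (hz : z ≠ 0) (β : ℝ) :
    ∃ w, cover w = z ∧ |w.re - β| ≤ Real.pi ∧ w.im = -Real.log ‖z‖ := by
  have hβ : ‖cover β‖ = 1 := by rw [norm_cover]; simp
  obtain ⟨w, h1, h2, h3⟩ := exists_cover_eq (div_ne_zero hz (cover_ne_zero β))
  refine ⟨w + β, ?_, by simpa using h2, by simpa [hβ] using h3⟩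
  have : cover (w + β) = cover w * cover β := by
    rw [cover, cover, cover, ← Complex.exp_add, mul_add]
  rw [this, h1, div_mul_cancel₀ _ (cover_ne_zero β)]

/-- A two constants theorem in the annulus for functions which are small on an arc of the
boundary. -/
theorem exists_two_constants_annulus {s : ℝ} (hs0 : 0 < s) (hs1 : s < 1) {ℓ : ℝ} (hℓ : 0 < ℓ) :
    ∃ c > 0, ∀ (f : ℂ → ℂ) (M m δ r α : ℝ), DifferentiableOn ℂ f (annulus s) →
      (∀ z ∈ annulus s, ‖deriv f z‖ ≤ M) → (∀ z ∈ annulus s, ‖f z‖ ≤ m) → 0 < δ → δ ≤ m →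
      (r = s ∨ r = 1) →
      (∀ θ ∈ Set.Icc α (α + ℓ), ‖bdryValue s f (circleMap 0 r θ)‖ ≤ δ) →
      ∀ z ∈ annulus s,
        ‖f z‖ ≤ m * Real.exp (-(c * min (1 - ‖z‖) (‖z‖ - s) * Real.log (m / δ))) := by
  have hq := q0_pos hs0 hs1
  obtain ⟨c, hc, h⟩ := exists_two_constants hq (ρ := ℓ / 4) (by positivity) Real.pi
  refine ⟨c, hc, ?_⟩
  intro f M m δ r α hf hM hm hδ hδm hr hsmall z hz
  have hm0 : 0 < m := hδ.trans_le hδm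
  have hz0 : 0 < ‖z‖ := hs0.trans hz.1
  set β := α + ℓ / 2 with hβ
  obtain ⟨w, rfl, hwβ, hwim⟩ := exists_cover_eq_near (ne_zero_of_mem_annulus hs0 hz) β
  have hw := (cover_mem_annulus_iff hs0 w).1 hz
  have hd := diffContOnCl_lift hs0 hs1 hf hM
  have hlm := fun v (hv : v ∈ closedStrip (q0 s)) =>
    norm_lift_le_of_norm_le hs0 hs1 hf hM hm hv
  -- Both comparisons follow from `log x ≤ x - 1`, at `x = |z|` and at `x = s / |z|`.
  have hdist : min (1 - ‖cover w‖) (‖cover w‖ - s) ≤ min w.im (q0 s - w.im) := by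
    refine min_le_min ?_ ?_
    · rw [hwim]; linarith [Real.log_le_sub_one_of_pos hz0]
    · have h1 := Real.log_le_sub_one_of_pos (div_pos hs0 hz0)
      rw [Real.log_div hs0.ne' hz0.ne'] at h1
      have h2 : s / ‖cover w‖ ≤ 1 - (‖cover w‖ - s) := by
        rw [div_le_iff₀ hz0]; nlinarith [hz.1, hz.2]
      rw [hwim, q0]; linarith
  have hlog : 0 ≤ Real.log (m / δ) := Real.log_nonneg ((one_le_div hδ).2 hδm)
  have hstrip : ‖f (cover w)‖ ≤
      m * Real.exp (-(c * min w.im (q0 s - w.im) * Real.log (m / δ))) := by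
    rw [← lift_eq hs0 hf hw]
    rcases hr with rfl | rfl
    · have h1 := h (fun v => lift r f (q0 r * Complex.I - (v + (-β : ℝ)))) m δ
        (DiffContOnCl.translate (DiffContOnCl.flip hd) (-β))
        (fun v hv => hlm _ (flip_mem_closedStrip_iff.2 (by simpa [closedStrip] using hv))) hδ hδm
        (fun x hx => by
          have e : (q0 r * Complex.I - ((x : ℂ) + (-β : ℝ))) = ((β - x : ℝ) : ℂ) + q0 r * Complex.I := by
            push_cast; ring
          rw [e, ← bdryValue_inner hs0 hs1 hf hM]
          rw [abs_le] at hx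
          exact hsmall _ ⟨by linarith, by linarith⟩)
        (q0 r * Complex.I - w + β) (by
          have := flip_mem_strip_iff.2 hw
          simpa [strip] using this) (by
          rw [abs_sub_comm] at hwβ
          convert hwβ using 2
          simp; ring)
      have e1 : (q0 r * Complex.I - (q0 r * Complex.I - w + β + (-β : ℝ))) = w := by
        push_cast; ring
      have e2 : (q0 r * Complex.I - w + β).im = q0 r - w.im := by simp
      simp only [e1, e2, sub_sub_cancel] at h1
      rwa [min_comm] at h1
    · have h1 := h (fun v => lift s f (v + β)) m δ (DiffContOnCl.translate hd β)
        (fun v hv => hlm _ (by simpa [closedStrip] using hv)) hδ hδm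
        (fun x hx => by
          rw [← Complex.ofReal_add, ← bdryValue_outer hs0 hs1 hf hM]
          rw [abs_le] at hx
          exact hsmall _ ⟨by linarith, by linarith⟩)
        (w - β) (by simpa [strip] using hw) (by simpa using hwβ)
      simpa using h1
  refine hstrip.trans ?_
  gcongr

theorem MemHardySobolev.hasDerivAt {s : ℝ} {k : ℕ} {f : ℂ → ℂ} (hf : MemHardySobolev s k f)
    {i : ℕ} (hi : i ≤ k) {z : ℂ} (hz : z ∈ annulus s) :
    HasDerivAt (iteratedDeriv i f) (iteratedDeriv (i + 1) f z) z := by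
  rw [iteratedDeriv_succ]
  exact ((hf i hi).1.differentiableAt ((isOpen_annulus s).mem_nhds hz)).hasDerivAt

theorem nonempty_annulus {s : ℝ} (hs0 : 0 < s) (hs1 : s < 1) : (annulus s).Nonempty := by
  refine ⟨((s + 1) / 2 : ℝ), ?_⟩
  rw [annulus, Set.mem_ofPred_eq, Complex.norm_real, Real.norm_of_nonneg (by linarith)]
  constructor <;> linarith

/-! ### Self-improvement and logarithmic decay -/

/-- A function whose derivatives of order at most `k` are bounded and which is of size `exp (-L)`
on an arc is of size `L ^ (-k)` in the annulus. -/
theorem exists_norm_le_pow {s : ℝ} (hs0 : 0 < s) (hs1 : s < 1) {ℓ : ℝ} (hℓ : 0 < ℓ) {K : ℝ}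
    (hK : 0 < K) {k : ℕ} (hk : 0 < k) :
    ∃ D > 0, ∀ f : ℂ → ℂ, MemHardySobolev s k f →
      (∀ i ≤ k, ∀ z ∈ annulus s, ‖iteratedDeriv i f z‖ ≤ K) →
      ∀ (r α L : ℝ), (r = s ∨ r = 1) → 0 < L →
      (∀ θ ∈ Set.Icc α (α + ℓ), ‖bdryValue s f (circleMap 0 r θ)‖ ≤ Real.exp (-(3 * L / 8))) →
      ∀ z ∈ annulus s, ‖f z‖ ≤ (D / L) ^ k := by
  obtain ⟨A, hA, hint⟩ := exists_norm_le_interpolation hs0 hs1 k hK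
  obtain ⟨c, hc, htwo⟩ := exists_two_constants_annulus hs0 hs1 hℓ
  have hs : 0 < 1 - s := by linarith
  -- The second entry ensures that the step `t = η / (4 A')` is at most `(1 - s) / 4`, the length of
  -- the radial segments.
  set A' := max A (max 1 K / (1 - s)) with hA'
  have hA'0 : 0 < A' := hA.trans_le (le_max_left _ _)
  have hk' : (0 : ℝ) < k := by exact_mod_cast hk
  refine ⟨max (128 * A' / c) (4 * k), by positivity, ?_⟩
  intro f hf hfK r α L hr hL hsmall
  have hfK0 : ∀ z ∈ annulus s, ‖f z‖ ≤ K := fun z hz => by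
    simpa using hfK 0 (Nat.zero_le k) z hz
  obtain ⟨z₀, hz₀⟩ := nonempty_annulus hs0 hs1
  have hne : Nonempty (annulus s) := ⟨⟨z₀, hz₀⟩⟩
  set m : ℝ := ⨆ z : annulus s, ‖f z‖ with hm
  have hfm : ∀ z ∈ annulus s, ‖f z‖ ≤ m := fun z hz =>
    le_ciSup (f := fun z : annulus s => ‖f z‖)
      ⟨K, by rintro _ ⟨w, rfl⟩; exact hfK0 w w.2⟩ ⟨z, hz⟩
  have hmK : m ≤ K := ciSup_le fun w => hfK0 w w.2
  have hm0 : 0 ≤ m := (norm_nonneg _).trans (hfm z₀ hz₀)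
  set η : ℝ := m ^ ((k : ℝ)⁻¹) with hη
  have hηk : η ^ k = m := Real.rpow_inv_natCast_pow hm0 hk.ne'
  have hη0 : 0 ≤ η := Real.rpow_nonneg hm0 _
  suffices hηL : η ≤ max (128 * A' / c) (4 * k) / L by
    intro z hz
    refine (hfm z hz).trans ?_
    rw [← hηk]
    gcongr
  -- If `m` is exponentially small, `exp (-x) ≤ 1 / x` suffices. Otherwise `log (m / δ) ≥ 3L/8 - L/4
  -- = L/8`, so the two constants theorem has force.
  rcases le_or_gt m (Real.exp (-(L / 4))) with hcase | hcase
  · have h1 : η ≤ Real.exp (-(L / (4 * k))) := by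
      refine le_of_pow_le_pow_left₀ hk.ne' (Real.exp_pos _).le ?_
      rw [hηk, ← Real.exp_nat_mul]
      refine hcase.trans (le_of_eq ?_)
      congr 1
      field_simp
    have h2 : Real.exp (-(L / (4 * k))) ≤ 4 * k / L := by
      rw [Real.exp_neg, ← inv_div L]
      have h3 : 0 < L / (4 * k) := by positivity
      gcongr
      linarith [Real.add_one_le_exp (L / (4 * k))]
    refine (h1.trans h2).trans ?_
    gcongr
    exact le_max_right _ _
  · have hmp : 0 < m := (Real.exp_pos _).trans hcase
    have hηp : 0 < η := by
      refine hη0.lt_of_ne fun h => ?_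
      rw [← h, zero_pow hk.ne'] at hηk
      linarith
    have hηE : η ≤ max 1 K := by
      rcases le_total η 1 with h | h
      · exact h.trans (le_max_left _ _)
      · refine le_trans ?_ ((hηk.le.trans hmK).trans (le_max_right _ _))
        exact le_self_pow₀ h hk.ne'
    set t := η / (4 * A') with ht
    have ht0 : 0 < t := by positivity
    have hts : t ≤ (1 - s) / 4 := by
      have h1 : max 1 K ≤ A' * (1 - s) := (div_le_iff₀ hs).1 (le_max_right _ _)
      rw [ht, div_le_div_iff₀ (by positivity) (by norm_num)]
      nlinarith
    obtain ⟨⟨z, hz⟩, hzm⟩ := exists_lt_of_lt_ciSup (show 3 / 4 * m < m by linarith)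
    obtain ⟨u, hu, hseg⟩ := exists_radial_segment hs0 hz
    obtain ⟨hz', hdist⟩ := hseg t ht0.le hts
    have hder : ∀ z ∈ annulus s, ‖iteratedDeriv 1 f z‖ ≤ A' * η ^ (k - 1) := fun z hz => by
      refine (hint (fun i => iteratedDeriv i f) (fun i hi z hz => hf.hasDerivAt hi.le hz) hfK η hηp
        (fun z hz => by rw [hηk]; simpa using hfm z hz) 1 hk z hz).trans ?_
      gcongr
      exact le_max_left _ _
    -- `t` is chosen so that `A' η^(k-1) t = m / 4`; starting above `3m/4`, the value stays above `m
    -- / 2`.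
    have hmove : ‖f (z + t * u) - f z‖ ≤ m / 4 := by
      have h1 := norm_add_mul_sub_le (g := iteratedDeriv 0 f) (g' := iteratedDeriv 1 f)
        (B := A' * η ^ (k - 1)) ht0.le hu
        (fun x h0 h1 => (hseg x h0 (h1.trans hts)).1)
        (fun z hz => hf.hasDerivAt (Nat.zero_le k) hz)
        (fun x h0 h1 => hder _ (hseg x h0 (h1.trans hts)).1)
      rw [iteratedDeriv_zero] at h1
      refine h1.trans (le_of_eq ?_)
      have h2 : η ^ (k - 1) * η = m := by rw [← pow_succ, Nat.sub_add_cancel hk, hηk]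
      rw [ht, ← h2]
      field_simp
    have hbig : m / 2 ≤ ‖f (z + t * u)‖ := by
      have h1 := norm_sub_norm_le (f z) (f (z + t * u))
      rw [norm_sub_rev] at h1
      change 3 / 4 * m < ‖f z‖ at hzm
      linarith
    have hδm : Real.exp (-(3 * L / 8)) ≤ m :=
      (Real.exp_le_exp.2 (by linarith)).trans hcase.le
    have hM : ∀ z ∈ annulus s, ‖deriv f z‖ ≤ K := fun z hz => by
      have := hfK 1 hk z hz
      rwa [iteratedDeriv_one] at this
    have hf0 : DifferentiableOn ℂ f (annulus s) := by
      have := (hf 0 (Nat.zero_le k)).1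
      rwa [iteratedDeriv_zero] at this
    have hsm := htwo f K m (Real.exp (-(3 * L / 8))) r α hf0 hM hfm (Real.exp_pos _) hδm hr hsmall
      _ hz'
    have hlog : L / 8 ≤ Real.log (m / Real.exp (-(3 * L / 8))) := by
      rw [Real.log_div hmp.ne' (Real.exp_pos _).ne', Real.log_exp]
      have := Real.log_le_log (Real.exp_pos _) hcase.le
      rw [Real.log_exp] at this
      linarith
    have hmin : t / 4 ≤ min (1 - ‖z + t * u‖) (‖z + t * u‖ - s) := by
      refine le_trans ?_ hdist
      rw [min_eq_right (by linarith)]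
    have hx : c * (t / 4) * (L / 8) ≤ 1 := by
      have h1 : m / 2 ≤ m * Real.exp (-(c * (t / 4) * (L / 8))) := by
        refine hbig.trans (hsm.trans ?_)
        have h2 : 0 ≤ c * min (1 - ‖z + t * u‖) (‖z + t * u‖ - s) :=
          mul_nonneg hc.le (le_trans (by positivity) hmin)
        gcongr
      have h2 : 1 / 2 ≤ Real.exp (-(c * (t / 4) * (L / 8))) := by
        refine le_of_mul_le_mul_left ?_ hmp
        linarith
      rw [Real.exp_neg, one_div, inv_le_inv₀ two_pos (Real.exp_pos _)] at h2
      linarith [Real.add_one_le_exp (c * (t / 4) * (L / 8))]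
    have hηL : η ≤ 128 * A' / c / L := by
      rw [le_div_iff₀ hL, le_div_iff₀ hc]
      have : c * (t / 4) * (L / 8) = η * L * c / (128 * A') := by
        rw [ht]; field_simp; norm_num
      rw [this, div_le_one (by positivity)] at hx
      exact hx
    refine hηL.trans ?_
    gcongr
    exact le_max_left _ _

/-- Logarithmic decay of all derivatives of order less than `k` in terms of the mean of `|f|` over
a connected relatively open subset of the boundary. -/
theorem exists_norm_iteratedDeriv_le {s : ℝ} (hs0 : 0 < s) (hs1 : s < 1) {lam : ℝ}
    (hlam0 : 0 < lam) (hlam1 : lam ≤ 1) {K : ℝ} (hK : 0 < K) {k : ℕ} (hk : 0 < k) :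
    ∃ D > 0, ∃ L₀ ≥ 1, ∀ I : Set ℂ, IsConnected I →
      (∃ U : Set ℂ, IsOpen U ∧ I = U ∩ bdry s) → bdryMeasure s I = ENNReal.ofReal lam →
      ∀ f : ℂ → ℂ, MemHardySobolev s k f →
      (∀ i ≤ k, ∀ z ∈ annulus s, ‖iteratedDeriv i f z‖ ≤ K) →
      ∀ L ≥ L₀, l1Norm s I f ≤ Real.exp (-L) →
      ∀ i ≤ k, ∀ z ∈ annulus s, ‖iteratedDeriv i f z‖ ≤ D / L ^ (k - i) := by
  have hpi := Real.pi_pos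
  have hℓ : 0 < Real.pi * lam := by positivity
  obtain ⟨A, hA, hint⟩ := exists_norm_le_interpolation hs0 hs1 k hK
  obtain ⟨E, hE, hpow⟩ := exists_norm_le_pow hs0 hs1 hℓ hK hk
  set S : ℝ := 2 / min (1 / (2 * K)) (Real.pi * lam / (2 * K)) * (2 * Real.pi * lam) with hS
  have hS0 : 0 < S := by positivity
  -- `L ≥ 4 S` gives `S ≤ exp S ≤ exp (L / 4)`, which absorbs the constant of the passage from mean
  -- to supremum.
  refine ⟨A * max 1 E ^ k, by positivity, 1 + 4 * S, by linarith, ?_⟩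
  rintro I hI ⟨U, hU, hIU⟩ hμ f hf hfK L hL hl1 i hi z hz
  have hL1 : 1 ≤ L := by linarith
  have hL0 : 0 < L := by linarith
  have hIb : I ⊆ bdry s := hIU ▸ Set.inter_subset_right
  have hIm : MeasurableSet I := by
    rw [hIU]; exact hU.measurableSet.inter (isCompact_bdry s).isClosed.measurableSet
  obtain ⟨r, hr, hIr, α, hα⟩ := exists_arc_subset hs0 hs1 hlam0 hI hIb hIm hμ
  have hf0 : DifferentiableOn ℂ f (annulus s) := by
    have := (hf 0 (Nat.zero_le k)).1
    rwa [iteratedDeriv_zero] at this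
  have hM : ∀ z ∈ annulus s, ‖deriv f z‖ ≤ K := fun z hz => by
    have := hfK 1 hk z hz
    rwa [iteratedDeriv_one] at this
  have hfK0 : ∀ z ∈ annulus s, ‖f z‖ ≤ K := fun z hz => by
    simpa using hfK 0 (Nat.zero_le k) z hz
  obtain ⟨hb, hLip⟩ := bdryValue_circle hs0 hs1 hf0 hM hK.le hfK0 hr
  have hcont : Continuous fun θ => bdryValue s f (circleMap 0 r θ) := by
    have : LipschitzWith K.toNNReal fun θ => bdryValue s f (circleMap 0 r θ) :=
      LipschitzWith.of_dist_le_mul fun x y => by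
        rw [Real.coe_toNNReal _ hK.le, Real.dist_eq, dist_eq_norm]; exact hLip x y
    exact this.continuous
  have harc := integral_arc_le hr hlam0 hlam1 hIm hIr hμ hcont hb hα
  have hsmall : ∀ θ ∈ Set.Icc α (α + Real.pi * lam),
      ‖bdryValue s f (circleMap 0 r θ)‖ ≤ Real.exp (-(3 * L / 8)) := by
    intro θ hθ
    have h1 := sq_le_integral (φ := fun θ => ‖bdryValue s f (circleMap 0 r θ)‖) hK hK hℓ
      (fun _ => norm_nonneg _) hb (fun x y => (abs_norm_sub_norm_le _ _).trans (hLip x y)) hθ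
    refine le_of_pow_le_pow_left₀ two_ne_zero (Real.exp_pos _).le (h1.trans ?_)
    calc _ ≤ 2 / min (1 / (2 * K)) (Real.pi * lam / (2 * K)) *
          (2 * Real.pi * lam * Real.exp (-L)) := by
          gcongr
          exact harc.trans (by gcongr)
      _ = S * Real.exp (-L) := by rw [hS]; ring
      _ ≤ Real.exp (L / 4) * Real.exp (-L) := by
          gcongr
          refine (by linarith [Real.add_one_le_exp S] : S ≤ Real.exp S).trans ?_
          exact Real.exp_le_exp.2 (by linarith)
      _ = Real.exp (-(3 * L / 8)) ^ 2 := by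
          rw [← Real.exp_add, ← Real.exp_nat_mul]; congr 1; push_cast; ring
  have h0 := hpow f hf hfK r α L hr hL0 hsmall
  refine (hint (fun i => iteratedDeriv i f) (fun i hi z hz => hf.hasDerivAt hi.le hz) hfK (E / L)
    (by positivity) (fun z hz => by simpa using h0 z hz) i hi z hz).trans ?_
  rw [div_pow, mul_div_assoc]
  gcongr
  calc E ^ (k - i) ≤ max 1 E ^ (k - i) := by gcongr; exact le_max_right _ _
    _ ≤ max 1 E ^ k := pow_le_pow_right₀ (le_max_left _ _) (Nat.sub_le k i)

/-- Bounds in the annulus for the derivatives pass to the Hardy–Sobolev norm. -/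
theorem hardySobolevNorm_bdry_le {s : ℝ} (hs0 : 0 < s) (hs1 : s < 1) {j k : ℕ} (hjk : j < k)
    {f : ℂ → ℂ} (hf : MemHardySobolev s k f) {B : ℝ}
    (hB : ∀ i ≤ j, ∀ z ∈ annulus s, ‖iteratedDeriv i f z‖ ≤ B) :
    hardySobolevNorm s j (bdry s) f ≤ ENNReal.ofReal (2 * B) := by
  refine Finset.sup_le fun i hi => ?_
  have hij : i ≤ j := Nat.lt_succ_iff.1 (Finset.mem_range.1 hi)
  obtain ⟨z₀, hz₀⟩ := nonempty_annulus hs0 hs1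
  have hB0 : 0 ≤ B := (norm_nonneg _).trans (hB i hij z₀ hz₀)
  obtain ⟨M, hM⟩ := hf.exists_deriv_bound (hij.trans_lt hjk)
  have hM0 : 0 ≤ M := (norm_nonneg _).trans (hM z₀ hz₀)
  have hc : ∀ {r : ℝ}, (r = s ∨ r = 1) → _ := fun {r} hr =>
    (bdryValue_circle hs0 hs1 (hf i (hij.trans hjk.le)).1 hM hM0 (hB i hij) hr).1
  rw [two_mul, ENNReal.ofReal_add hB0 hB0]
  exact add_le_add (supNorm_sphere_le hs0.le (Or.inl rfl) (hc (Or.inl rfl)))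
    (supNorm_sphere_le zero_le_one (Or.inr rfl) (hc (Or.inr rfl)))

end AnnulusHardy

theorem corollary3p8 (s : ℝ) (hs0 : 0 < s) (hs1 : s < 1) (lam : ℝ) (hlam0 : 0 < lam)
    (hlam1 : lam ≤ 1) (K : ℝ) (hK : 0 < K) (j k : ℕ) (hjk : j < k) :
    ∃ C ε : ℝ, 0 < C ∧ 0 < ε ∧
      ∀ I : Set ℂ, IsConnected I →
        (∃ U : Set ℂ, IsOpen U ∧ I = U ∩ AnnulusHardy.bdry s) →
        AnnulusHardy.bdryMeasure s I = ENNReal.ofReal lam →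
        ∀ f : ℂ → ℂ, AnnulusHardy.MemHardySobolev s k f →
          AnnulusHardy.hardySobolevNorm s k (AnnulusHardy.bdry s) f ≤ ENNReal.ofReal K →
          AnnulusHardy.hardySobolevNorm s j I f <
            ENNReal.ofReal
              (Real.exp (-(AnnulusHardy.q0 s / (lam * AnnulusHardy.kernelConst s)))) →
          AnnulusHardy.l1Norm s I f < ε →
          AnnulusHardy.hardySobolevNorm s j (AnnulusHardy.bdry s) f ≤
            ENNReal.ofReal (C / |Real.log (AnnulusHardy.l1Norm s I f)| ^ (k - j)) := by
  have hk : 0 < k := (Nat.zero_le j).trans_lt hjk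
  obtain ⟨D, hD, L₀, hL₀, h⟩ := AnnulusHardy.exists_norm_iteratedDeriv_le hs0 hs1 hlam0 hlam1
    (div_pos hK hs0) hk
  refine ⟨2 * D, Real.exp (-L₀), by positivity, Real.exp_pos _, ?_⟩
  intro I hI hU hμ f hf hfK _ hl1
  have hbound := h I hI hU hμ f hf
    (fun i hi z hz => AnnulusHardy.norm_iteratedDeriv_le hs0 hs1 hK.le hf hfK hk hi hz)
  have hbound' : ∀ L ≥ L₀, AnnulusHardy.l1Norm s I f ≤ Real.exp (-L) →
      AnnulusHardy.hardySobolevNorm s j (AnnulusHardy.bdry s) f ≤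
        ENNReal.ofReal (2 * (D / L ^ (k - j))) := fun L hL hle =>
    AnnulusHardy.hardySobolevNorm_bdry_le hs0 hs1 hjk hf fun i hi z hz => by
      refine (hbound L hL hle i (hi.trans hjk.le) z hz).trans ?_
      have hL1 : 1 ≤ L := le_trans hL₀ hL
      gcongr
  -- When the mean vanishes the estimate holds for every `L ≥ L₀`, and `L → ∞` shows that the norm
  -- is `0`. Here `Real.log 0 = 0` and `k - j > 0`, so the right-hand side is indeed read as `0`.
  rcases (AnnulusHardy.l1Norm_nonneg s I f).eq_or_lt with h0 | h0
  · have hlim : Tendsto (fun L : ℝ => ENNReal.ofReal (2 * (D / L ^ (k - j)))) atTop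
        (𝓝 (ENNReal.ofReal (2 * 0))) := by
      refine ENNReal.tendsto_ofReal (Tendsto.const_mul 2 ?_)
      exact tendsto_const_nhds.div_atTop (tendsto_pow_atTop (Nat.sub_pos_of_lt hjk).ne')
    have hle := ge_of_tendsto hlim (b := AnnulusHardy.hardySobolevNorm s j (AnnulusHardy.bdry s) f)
      (by
        filter_upwards [eventually_ge_atTop L₀] with L hL
        exact hbound' L hL (h0 ▸ (Real.exp_pos _).le))
    refine hle.trans (ENNReal.ofReal_le_ofReal ?_)
    rw [mul_zero]
    positivity
  · have hlog : Real.log (AnnulusHardy.l1Norm s I f) < -L₀ := by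
      rw [← Real.log_exp (-L₀)]; exact Real.log_lt_log h0 hl1
    rw [abs_of_neg (by linarith), mul_div_assoc]
    exact hbound' _ (by linarith) (by rw [neg_neg, Real.exp_log h0])
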